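/- Let $n\ge 4$. Let $Ab(n)$ be the set of abelian $(n-1)$-dimensional Lie subalgebras of $\mathfrak{sl}_n(\mathbb C)$, a closed subset of the Grassmannian $G(n-1,\mathfrak{sl}_n)$; it also carries the scheme structure given by the equations $[X,Y]=0$ for $X,Y$ in the tautological subbundle. Let $Red(n)\subset Ab(n)$ be the variety of reductions, i.e. the Zariski closure in $G(n-1,\mathfrak{sl}_n)$ of the set of Cartan subalgebras of $\mathfrak{sl}_n$, with its reduced structure. For a linear subspace $L\subset\mathbb C^n$ let $\mathfrak a(L)$ be the space of endomorphisms of $\mathbb C^n$ whose image is contained in $L$ and whose kernel contains $L$. Let $\mathcal O'_{min}$ (a copy of $\mathbb P^{n-1}$) be the set of all $\mathfrak a(L)$ with $L$ a line, and let $\mathcal O''_{min}$ (a copy of the dual projective space $\check{\mathbb P}^{n-1}$) be the set of all $\mathfrak a(L)$ with $L$ a hyperplane. Let $e_1,\dots,e_n$ be the standard basis of $\mathbb C^n$, let $U=\langle e_1,\dots,e_{n-1}\rangle$, let $\iota:U\to\mathbb C^n$ be the inclusion, $\pi:\mathbb C^n\to U$ the projection along $e_n$, and $J$ the endomorphism $Je_i=e_{i+1}$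 of $\mathbb C^n$, with indices modulo $n$. Let $B\in Hom(U,End(U))$ be given by $B(e_i)=\pi J^i\iota$ for $1\le i\le n-1$, and let $C_n$ be the Zariski closure of the orbit of $[B]$ under the natural action of $PGL(U)$ on $\mathbb P(Hom(U,End(U)))$. Then: (1) $\mathcal O'_{min}$ and $\mathcal O''_{min}$ are contained in the singular locus of $Red(n)$. (2) At every point of $\mathcal O'_{min}\cup\mathcal O''_{min}$ the Zariski tangent space of $Ab(n)$, for the above scheme structure as well as for the reduced structure, has dimension $n(n-1)^2/2$. (3) $C_n$ is not a linear subspace of $\mathbb P(Hom(U,End(U)))$. -/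

import Mathlib

open Matrix

attribute [local instance] LieRing.ofAssociativeRing

noncomputable section

/-! ### The Grassmannian as a variety, through its affine charts

Points of the Grassmannian of `k`-planes in `V` are submodules of rank `k`. A basis of `V` indexed
by `Fin k ⊕ Fin m` gives a standard affine chart isomorphic to affine `k * m`-space. -/

section Grassmannian

variable {V : Type*} [AddCommGroup V] [Module ℂ V] {k m : ℕ}

/-- The set of points of the Grassmannian of `k`-dimensional subspaces of `V`. -/
def grassmannian (k : ℕ) (V : Type*) [AddCommGroup V] [Module ℂ V] : Set (Submodule ℂ V) :=
  {W | Module.finrank ℂ W = k}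

/-- The standard affine chart of the Grassmannian attached to a basis `v₁, …, vₖ, w₁, …, wₘ` of `V`:
it sends a matrix `x` to the span of the vectors `vᵢ + ∑ⱼ xᵢⱼ wⱼ`. -/
def grChart (b : Module.Basis (Fin k ⊕ Fin m) ℂ V) (x : Fin k × Fin m → ℂ) : Submodule ℂ V :=
  Submodule.span ℂ (Set.range fun i => b (Sum.inl i) + ∑ j, x (i, j) • b (Sum.inr j))

/-- The chart is centred at `W`, i.e. its origin is `W`, the span of `v₁, …, vₖ`. -/
def IsCentredAt (b : Module.Basis (Fin k ⊕ Fin m) ℂ V) (W : Submodule ℂ V) : Prop :=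
  grChart b 0 = W

/-- A set of `k`-planes in a space of dimension `k + m` is Zariski closed in the Grassmannian if its
trace on each standard affine chart is the zero locus of an ideal of polynomials. -/
def IsGrClosed (k m : ℕ) (Z : Set (Submodule ℂ V)) : Prop :=
  Z ⊆ grassmannian k V ∧
    ∀ b : Module.Basis (Fin k ⊕ Fin m) ℂ V,
      ∃ I : Ideal (MvPolynomial (Fin k × Fin m) ℂ),
        grChart b ⁻¹' Z = MvPolynomial.zeroLocus ℂ I

/-- Zariski closure in the Grassmannian of `k`-planes in a space of dimension `k + m`. -/
def grClosure (k m : ℕ) (S : Set (Submodule ℂ V)) : Set (Submodule ℂ V) :=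
  ⋂₀ {Z | IsGrClosed k m Z ∧ S ⊆ Z}

end Grassmannian

/-! ### Local rings and Zariski tangent spaces -/

/-- The maximal ideal of the origin of affine space with coordinates indexed by `σ`. -/
def originIdeal (σ : Type) : Ideal (MvPolynomial σ ℂ) :=
  RingHom.ker (MvPolynomial.eval (0 : σ → ℂ))

instance (σ : Type) : (originIdeal σ).IsPrime :=
  RingHom.ker_isPrime _

/-- The local ring at the origin of the closed subscheme of affine space defined by the ideal `J`:
the localization of the polynomial ring at the origin, modulo the ideal generated by `J`. -/
abbrev LocalRingAtOrigin {σ : Type} (J : Ideal (MvPolynomial σ ℂ)) : Type :=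
  Localization.AtPrime (originIdeal σ) ⧸
    J.map (algebraMap (MvPolynomial σ ℂ) (Localization.AtPrime (originIdeal σ)))

/-- The Zariski tangent space attached to a local ring: the dual of `𝔪 / 𝔪²`. -/
abbrev ZariskiTangentSpace (R : Type*) [CommRing R] [IsLocalRing R] : Type _ :=
  Module.Dual (IsLocalRing.ResidueField R) (IsLocalRing.CotangentSpace R)

/-- The subscheme of affine space with ideal `J` passes through the origin, and its Zariski tangent
space there has dimension `d`. -/
def HasTangentDimAtOrigin {σ : Type} (J : Ideal (MvPolynomial σ ℂ)) (d : ℕ) : Prop :=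
  ∃ _ : IsLocalRing (LocalRingAtOrigin J),
    Module.Finite (IsLocalRing.ResidueField (LocalRingAtOrigin J))
      (ZariskiTangentSpace (LocalRingAtOrigin J)) ∧
    Module.finrank (IsLocalRing.ResidueField (LocalRingAtOrigin J))
      (ZariskiTangentSpace (LocalRingAtOrigin J)) = d

section Grassmannian

variable {V : Type*} [AddCommGroup V] [Module ℂ V] {k m : ℕ}

/-- The ideal, in the coordinates of a chart, of all polynomials vanishing on `Z`. -/
def chartIdeal (b : Module.Basis (Fin k ⊕ Fin m) ℂ V) (Z : Set (Submodule ℂ V)) :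
    Ideal (MvPolynomial (Fin k × Fin m) ℂ) :=
  MvPolynomial.vanishingIdeal ℂ (grChart b ⁻¹' Z)

/-- The singular locus of a Zariski closed set `Z` of the Grassmannian (with its reduced structure):
the points of `Z` whose local ring, computed in a standard chart centred at the point, is not
regular. (The local ring does not depend on the chart, up to isomorphism.) -/
def grSingularLocus (k m : ℕ) (Z : Set (Submodule ℂ V)) : Set (Submodule ℂ V) :=
  {W | W ∈ Z ∧ ∃ b : Module.Basis (Fin k ⊕ Fin m) ℂ V, IsCentredAt b W ∧
    ¬ IsRegularLocalRing (LocalRingAtOrigin (chartIdeal b Z))}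

end Grassmannian

/-! ### Abelian subalgebras of `𝔰𝔩ₙ` and the variety of reductions -/

/-- The Lie algebra `𝔰𝔩ₙ` over the complex numbers. -/
abbrev Sl (n : ℕ) : LieSubalgebra ℂ (Matrix (Fin n) (Fin n) ℂ) :=
  LieAlgebra.SpecialLinear.sl (Fin n) ℂ

/-- The set of Cartan subalgebras of `𝔰𝔩ₙ`, as points of the Grassmannian. -/
def Red₀ (n : ℕ) : Set (Submodule ℂ (Sl n)) :=
  {W | ∃ H : LieSubalgebra ℂ (Sl n), H.IsCartanSubalgebra ∧ H.toSubmodule = W}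

/-- The variety of reductions: the Zariski closure of the set of Cartan subalgebras in the
Grassmannian of `(n-1)`-planes of `𝔰𝔩ₙ`, where `dim 𝔰𝔩ₙ = (n - 1) + n (n - 1)`. -/
def Red (n : ℕ) : Set (Submodule ℂ (Sl n)) :=
  grClosure (n - 1) (n * (n - 1)) (Red₀ n)

/-- The set of `(n-1)`-dimensional abelian subalgebras of `𝔰𝔩ₙ`. -/
def AbVar (n : ℕ) : Set (Submodule ℂ (Sl n)) :=
  {W | W ∈ grassmannian (n - 1) (Sl n) ∧ ∀ X ∈ W, ∀ Y ∈ W, ⁅X, Y⁆ = 0}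

/-- The `i`-th vector of the universal frame of a chart of the Grassmannian, a matrix with polynomial
entries in the coordinates of the chart. -/
def universalFrame {n k m : ℕ} (b : Module.Basis (Fin k ⊕ Fin m) ℂ (Sl n)) (i : Fin k) :
    Matrix (Fin n) (Fin n) (MvPolynomial (Fin k × Fin m) ℂ) :=
  (b (Sum.inl i) : Matrix (Fin n) (Fin n) ℂ).map MvPolynomial.C +
    ∑ j, (MvPolynomial.X (i, j) : MvPolynomial (Fin k × Fin m) ℂ) •
      (b (Sum.inr j) : Matrix (Fin n) (Fin n) ℂ).map MvPolynomial.C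

/-- The equations of the scheme of abelian subalgebras in a chart of the Grassmannian: the entries of
the commutators of the members of the universal frame. -/
def abSchemeIdeal {n k m : ℕ} (b : Module.Basis (Fin k ⊕ Fin m) ℂ (Sl n)) :
    Ideal (MvPolynomial (Fin k × Fin m) ℂ) :=
  Ideal.span {f | ∃ (i j : Fin k) (p q : Fin n),
    f = (universalFrame b i * universalFrame b j - universalFrame b j * universalFrame b i) p q}

/-- The traceless matrices whose image is contained in `L` and whose kernel contains `L`. -/
def nilSubalgebra {n : ℕ} (L : Submodule ℂ (Fin n → ℂ)) : Submodule ℂ (Sl n) where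
  carrier := {X | (∀ v, (X : Matrix (Fin n) (Fin n) ℂ) *ᵥ v ∈ L) ∧
    ∀ v ∈ L, (X : Matrix (Fin n) (Fin n) ℂ) *ᵥ v = 0}
  zero_mem' := by simp
  add_mem' := by
    rintro X Y ⟨hX, hX'⟩ ⟨hY, hY'⟩
    refine ⟨fun v => ?_, fun v hv => ?_⟩
    · simpa [add_mulVec] using L.add_mem (hX v) (hY v)
    · simp [add_mulVec, hX' v hv, hY' v hv]
  smul_mem' := by
    rintro c X ⟨hX, hX'⟩
    refine ⟨fun v => ?_, fun v hv => ?_⟩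
    · simpa [smul_mulVec] using L.smul_mem c (hX v)
    · simp [smul_mulVec, hX' v hv]

/-- The minimal orbit parametrized by the lines of `ℂⁿ`. -/
def OMin' (n : ℕ) : Set (Submodule ℂ (Sl n)) :=
  {W | ∃ L : Submodule ℂ (Fin n → ℂ), Module.finrank ℂ L = 1 ∧ nilSubalgebra L = W}

/-- The minimal orbit parametrized by the hyperplanes of `ℂⁿ`. -/
def OMin'' (n : ℕ) : Set (Submodule ℂ (Sl n)) :=
  {W | ∃ U : Submodule ℂ (Fin n → ℂ), Module.finrank ℂ U = n - 1 ∧ nilSubalgebra U = W}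

/-! ### The projective variety `Cₙ` of tangent directions

Let `U = ℂⁿ⁻¹`, the span of the first `n - 1` vectors of the standard basis of `ℂⁿ`. -/

/-- The space `Hom(U, End U)`, for `U = ℂⁿ⁻¹`. -/
abbrev HomEnd (n : ℕ) : Type :=
  (Fin (n - 1) → ℂ) →ₗ[ℂ] Matrix (Fin (n - 1)) (Fin (n - 1)) ℂ

/-- The cyclic endomorphism `J` of `ℂⁿ`, which maps `eᵢ` to `eᵢ₊₁`, indices modulo `n`. -/
def cyclicMatrix (n : ℕ) : Matrix (Fin n) (Fin n) ℂ :=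
  Matrix.of fun p q => if (p : ℕ) = ((q : ℕ) + 1) % n then 1 else 0

/-- The compression to `U` of an endomorphism of `ℂⁿ`: inclusion of `U`, then the endomorphism, then
the projection to `U` that kills the last basis vector. -/
def compression {n : ℕ} (M : Matrix (Fin n) (Fin n) ℂ) :
    Matrix (Fin (n - 1)) (Fin (n - 1)) ℂ :=
  M.submatrix (Fin.castLE (Nat.sub_le n 1)) (Fin.castLE (Nat.sub_le n 1))

/-- The element `B` of `Hom(U, End U)` that maps the `i`-th basis vector (`1 ≤ i ≤ n - 1`) to the
compression of `J ^ i`; since `Fin` counts from `0`, the exponent is `i + 1` here. -/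
def cyclicB (n : ℕ) : HomEnd n :=
  ∑ i : Fin (n - 1),
    (LinearMap.proj i : (Fin (n - 1) → ℂ) →ₗ[ℂ] ℂ).smulRight
      (compression (cyclicMatrix n ^ ((i : ℕ) + 1)))

/-- The natural action of `GL(U)` on `Hom(U, End U)`: `(g • B)(u) = g B(g⁻¹ u) g⁻¹`. -/
def glAct {n : ℕ} (g : GL (Fin (n - 1)) ℂ) (B : HomEnd n) : HomEnd n where
  toFun u := g.val * B (g⁻¹.val *ᵥ u) * g⁻¹.val
  map_add' u v := by simp only [mulVec_add, map_add, mul_add, add_mul]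
  map_smul' c u := by
    simp only [mulVec_smul, map_smul, Matrix.mul_smul, Matrix.smul_mul, RingHom.id_apply]

/-- The coordinates of an element of `Hom(U, End U)`. -/
def homEndCoord {n : ℕ} (B : HomEnd n) : Fin (n - 1) × Fin (n - 1) × Fin (n - 1) → ℂ :=
  fun t => B (Pi.single t.1 1) t.2.2 t.2.1

/-- Zariski closure in the projective space of `Hom(U, End U)`: the common zeros of the homogeneous
polynomials that vanish on `S`. -/
def projClosure {n : ℕ} (S : Set (Projectivization ℂ (HomEnd n))) :
    Set (Projectivization ℂ (HomEnd n)) :=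
  {x | ∀ (d : ℕ) (f : MvPolynomial (Fin (n - 1) × Fin (n - 1) × Fin (n - 1)) ℂ),
    f.IsHomogeneous d → (∀ y ∈ S, MvPolynomial.eval (homEndCoord y.rep) f = 0) →
      MvPolynomial.eval (homEndCoord x.rep) f = 0}

/-- The orbit of the point `[B]` of the projective space of `Hom(U, End U)` under `PGL(U)`. -/
def orbitB (n : ℕ) : Set (Projectivization ℂ (HomEnd n)) :=
  {x | ∃ (g : GL (Fin (n - 1)) ℂ) (h : glAct g (cyclicB n) ≠ 0),
    x = Projectivization.mk ℂ (glAct g (cyclicB n)) h}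

/-- The variety `Cₙ`: the Zariski closure of the orbit of `[B]`. -/
def Cvar (n : ℕ) : Set (Projectivization ℂ (HomEnd n)) :=
  projClosure (orbitB n)

end

/-! Put m = n - 1 and U = ℂ^m. Conjugations and X ↦ -Xᵀ are automorphisms of 𝔰𝔩ₙ, so they preserve
`Red n` and the equations of Ab(n). They carry one base point, the algebra of the hyperplane U, to
every point of both orbits, so one chart suffices. In it a nearby space is a graph u ↦ (A(u), u;
β(u), 0) modulo scalars, with A(u) in End U and β(u) in U*. Being abelian forces A(u)v = A(v)u and
[A(u), A(v)] = v ⊗ β(u) - u ⊗ β(v).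

Upper bound for the tangent space: the linear parts of these equations make A symmetric and kill β,
which leaves S²U* ⊗ U, of dimension n(n-1)²/2 (`X_mem_abSchemeIdeal_sup`). Lower bound: if β = 0 and
A is the multiplication of a semisimple commutative algebra on U, the graph is a Cartan subalgebra.
Letting such algebras degenerate puts into `Red n` all multiples of the products λ² ⊗ w with λ(w) =
1, and these span S²U* ⊗ U (`symDirection_mem`). Cartan subalgebras are conjugate to the diagonal
one (`exists_eq_map_diagSl`), hence `Red n` lies in Ab(n), and the bounds hold for `Red n`, for
Ab(n) reduced and for Ab(n) as a scheme.

Singularity: rows of the commutator equation free of β are quadrics in A. Setting to zero all but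
two suitable coordinates x, y of S²U* ⊗ U leaves xy = 0 (`X_mul_X_mem_abSchemeIdeal_sup`). If the
local ring were regular of dimension d, killing d - 2 generators of its maximal ideal would leave
dimension at least 2, but two generators with product zero allow dimension at most 1
(`not_isRegularLocalRing_of_mul_mem`).

Non-linearity: quadrics of the same kind vanish on `Cvar n`, but one of them does not vanish on the
sum of B and a diagonal translate of B (`not_linear_cvar`). -/

noncomputable section

/-! ### Tangent vectors at the origin and the cotangent space -/

section TangentVectors

variable {σ : Type}

/-- Evaluation of polynomials at the point of the dual numbers given by a tangent vector `v` at
the origin. -/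
def evalDual (v : σ → ℂ) : MvPolynomial σ ℂ →ₐ[ℂ] DualNumber ℂ :=
  MvPolynomial.aeval fun s => (TrivSqZeroExt.inr (v s) : DualNumber ℂ)

@[simp] lemma evalDual_X (v : σ → ℂ) (s : σ) :
    evalDual v (MvPolynomial.X s) = TrivSqZeroExt.inr (v s) := by
  simp [evalDual]

lemma fst_evalDual (v : σ → ℂ) (f : MvPolynomial σ ℂ) :
    (evalDual v f).fst = MvPolynomial.eval 0 f := by
  have : ((TrivSqZeroExt.fstHom ℂ ℂ ℂ).comp (evalDual v)) =
      MvPolynomial.aeval (0 : σ → ℂ) := by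
    ext s; simp
  have h := DFunLike.congr_fun this f
  simpa [MvPolynomial.aeval_eq_eval] using h

/-- The second component of `evalDual v f` is the derivative of `f` at the origin along `v`. Its
linearity in `v` is what makes the tangent vectors a subspace. -/
lemma snd_evalDual_add (v w : σ → ℂ) (f : MvPolynomial σ ℂ) :
    (evalDual (v + w) f).snd = (evalDual v f).snd + (evalDual w f).snd := by
  induction f using MvPolynomial.induction_on with
  | C a => simp [evalDual, TrivSqZeroExt.algebraMap_eq_inl]
  | add p q hp hq => simp only [map_add, TrivSqZeroExt.snd_add, hp, hq]; ring
  | mul_X p s hp =>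
    simp only [map_mul, evalDual_X, DualNumber.snd_mul, TrivSqZeroExt.snd_inr,
      TrivSqZeroExt.fst_inr, fst_evalDual, Pi.add_apply]
    ring

lemma snd_evalDual_smul (c : ℂ) (v : σ → ℂ) (f : MvPolynomial σ ℂ) :
    (evalDual (c • v) f).snd = c * (evalDual v f).snd := by
  induction f using MvPolynomial.induction_on with
  | C a => simp [evalDual, TrivSqZeroExt.algebraMap_eq_inl]
  | add p q hp hq => simp only [map_add, TrivSqZeroExt.snd_add, hp, hq]; ring
  | mul_X p s hp =>
    simp only [map_mul, evalDual_X, DualNumber.snd_mul, TrivSqZeroExt.snd_inr,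
      TrivSqZeroExt.fst_inr, fst_evalDual, Pi.smul_apply, smul_eq_mul]
    ring

/-- The tangent vectors at the origin of the subscheme of affine space with ideal `J`. -/
def tangentAtOrigin (J : Ideal (MvPolynomial σ ℂ)) : Submodule ℂ (σ → ℂ) where
  carrier := {v | ∀ f ∈ J, (evalDual v f).snd = 0}
  zero_mem' f _ := by simpa using snd_evalDual_smul 0 0 f
  add_mem' hv hw f hf := by rw [snd_evalDual_add, hv f hf, hw f hf, add_zero]
  smul_mem' c v hv f hf := by rw [snd_evalDual_smul, hv f hf, mul_zero]

lemma tangentAtOrigin_anti {J K : Ideal (MvPolynomial σ ℂ)} (h : J ≤ K) :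
    tangentAtOrigin K ≤ tangentAtOrigin J := fun _ hv f hf => hv f (h hf)

/-- A line contained in a set of points is a tangent direction of its vanishing ideal. -/
lemma mem_tangentAtOrigin_of_line {Z : Set (σ → ℂ)} {v : σ → ℂ} (h : ∀ t : ℂ, t • v ∈ Z) :
    v ∈ tangentAtOrigin (MvPolynomial.vanishingIdeal ℂ Z) := by
  intro f hf
  -- `g` is the restriction of `f` to the line. It vanishes at every complex number, hence is the
  -- zero polynomial, and evaluating it at `eps` gives the derivative.
  set g : Polynomial ℂ := MvPolynomial.aeval (fun s => Polynomial.C (v s) * Polynomial.X) f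
  have hg : g = 0 := by
    refine Polynomial.funext fun t => ?_
    have h1 : (Polynomial.aeval t : Polynomial ℂ →ₐ[ℂ] ℂ).comp
        (MvPolynomial.aeval fun s => Polynomial.C (v s) * Polynomial.X) =
        MvPolynomial.aeval (t • v) := by
      refine MvPolynomial.algHom_ext fun s => ?_
      simp only [AlgHom.comp_apply, MvPolynomial.aeval_X, map_mul, Polynomial.aeval_X,
        Polynomial.aeval_C, Pi.smul_apply, smul_eq_mul]
      exact mul_comm _ _
    have h2 := DFunLike.congr_fun h1 f
    have h3 : MvPolynomial.aeval (t • v) f = 0 := MvPolynomial.mem_vanishingIdeal_iff.mp hf _ (h t)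
    rw [h3] at h2
    rw [Polynomial.eval_zero, ← h2, AlgHom.comp_apply, Polynomial.coe_aeval_eq_eval]
  have h4 : (Polynomial.aeval (DualNumber.eps : DualNumber ℂ) : Polynomial ℂ →ₐ[ℂ] _).comp
      (MvPolynomial.aeval fun s => Polynomial.C (v s) * Polynomial.X) = evalDual v := by
    ext s <;> simp [TrivSqZeroExt.algebraMap_eq_inl]
  have h5 := DFunLike.congr_fun h4 f
  rw [← h5]
  change TrivSqZeroExt.snd (Polynomial.aeval (DualNumber.eps : DualNumber ℂ) g) = 0
  simp [hg]

end TangentVectors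

/-! ### Local rings at the origin: embedding dimension and a criterion for non-regularity. -/

section LocalRing

open IsLocalRing

variable {σ : Type} {J : Ideal (MvPolynomial σ ℂ)}

lemma mem_originIdeal {f : MvPolynomial σ ℂ} :
    f ∈ originIdeal σ ↔ MvPolynomial.eval 0 f = 0 := Iff.rfl

lemma originIdeal_eq_span : originIdeal σ = Ideal.span (Set.range MvPolynomial.X) := by
  have key (f : MvPolynomial σ ℂ) : f - MvPolynomial.C (MvPolynomial.eval 0 f) ∈
      Ideal.span (Set.range (MvPolynomial.X : σ → MvPolynomial σ ℂ)) := by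
    induction f using MvPolynomial.induction_on with
    | C a => simp
    | add p q hp hq =>
      rw [map_add, map_add, add_sub_add_comm]
      exact add_mem hp hq
    | mul_X p s hp =>
      simpa using Ideal.mul_mem_left _ p (Ideal.subset_span (Set.mem_range_self s))
  refine le_antisymm (fun f hf => ?_) ?_
  · have := key f
    rwa [mem_originIdeal.mp hf, map_zero, sub_zero] at this
  · rw [Ideal.span_le]
    rintro _ ⟨s, rfl⟩
    simp [mem_originIdeal]

/-- The natural map from the polynomial ring to the local ring at the origin. -/
def toLocalRingAtOrigin (J : Ideal (MvPolynomial σ ℂ)) :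
    MvPolynomial σ ℂ →+* LocalRingAtOrigin J :=
  (Ideal.Quotient.mk _).comp (algebraMap _ (Localization.AtPrime (originIdeal σ)))

lemma toLocalRingAtOrigin_eq_zero {f : MvPolynomial σ ℂ} (hf : f ∈ J) :
    toLocalRingAtOrigin J f = 0 :=
  Ideal.Quotient.eq_zero_iff_mem.mpr (Ideal.mem_map_of_mem _ hf)

lemma isLocalRing_localRingAtOrigin (hJ : J ≤ originIdeal σ) :
    IsLocalRing (LocalRingAtOrigin J) := by
  have hne : J.map (algebraMap (MvPolynomial σ ℂ) (Localization.AtPrime (originIdeal σ))) ≠ ⊤ := by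
    intro h
    have h1 := Ideal.map_mono (f := algebraMap (MvPolynomial σ ℂ)
      (Localization.AtPrime (originIdeal σ))) hJ
    rw [h, Localization.AtPrime.map_eq_maximalIdeal, top_le_iff] at h1
    exact (maximalIdeal.isMaximal _).ne_top h1
  have : Nontrivial (LocalRingAtOrigin J) := Ideal.Quotient.nontrivial_iff.mpr hne
  exact IsLocalRing.of_surjective' _ Ideal.Quotient.mk_surjective

lemma maximalIdeal_localRingAtOrigin [IsLocalRing (LocalRingAtOrigin J)] :
    maximalIdeal (LocalRingAtOrigin J) =
      (originIdeal σ).map (toLocalRingAtOrigin J) := by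
  rw [toLocalRingAtOrigin, ← Ideal.map_map, Localization.AtPrime.map_eq_maximalIdeal]
  have hs : Function.Surjective (Ideal.Quotient.mk
    (J.map (algebraMap (MvPolynomial σ ℂ) (Localization.AtPrime (originIdeal σ))))) :=
    Ideal.Quotient.mk_surjective
  have hm := Ideal.comap_isMaximal_of_surjective _ hs (K := maximalIdeal (LocalRingAtOrigin J))
  rw [← IsLocalRing.eq_maximalIdeal hm, Ideal.map_comap_of_surjective _ hs]

/-- The map from the local ring at the origin to the dual numbers given by a tangent vector. -/
def localEvalDual (hJ : J ≤ originIdeal σ) {v : σ → ℂ} (hv : v ∈ tangentAtOrigin J) :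
    LocalRingAtOrigin J →+* DualNumber ℂ :=
  Ideal.Quotient.lift _
    (IsLocalization.lift (M := (originIdeal σ).primeCompl) (g := (evalDual v).toRingHom) fun y => by
      have := y.2
      rw [Ideal.mem_primeCompl_iff, mem_originIdeal, ← fst_evalDual v] at this
      exact TrivSqZeroExt.isUnit_iff_isUnit_fst.mpr (isUnit_iff_ne_zero.mpr this))
    (fun a ha => by
      rw [← RingHom.mem_ker]
      refine (Ideal.map_le_iff_le_comap.mpr fun f hf => ?_) ha
      simp only [Ideal.mem_comap, RingHom.mem_ker, IsLocalization.lift_eq]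
      refine TrivSqZeroExt.ext ?_ (hv f hf)
      exact (fst_evalDual v f).trans (hJ hf))

lemma localEvalDual_toLocal (hJ : J ≤ originIdeal σ) {v : σ → ℂ} (hv : v ∈ tangentAtOrigin J)
    (f : MvPolynomial σ ℂ) :
    localEvalDual hJ hv (toLocalRingAtOrigin J f) = evalDual v f := by
  rw [localEvalDual, toLocalRingAtOrigin, RingHom.comp_apply, Ideal.Quotient.lift_mk,
    IsLocalization.lift_eq]
  rfl

instance [Finite σ] : IsNoetherianRing (LocalRingAtOrigin J) := by
  have : IsNoetherianRing (Localization.AtPrime (originIdeal σ)) :=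
    IsLocalization.isNoetherianRing (originIdeal σ).primeCompl _ inferInstance
  infer_instance

variable {ι : Type} {e : ι → σ}

/-- If the coordinates `e i` generate the other ones modulo `J`, then their germs generate the
maximal ideal. -/
lemma maximalIdeal_eq_span_coords [IsLocalRing (LocalRingAtOrigin J)]
    (hgen : ∀ s, MvPolynomial.X s ∈
      J ⊔ Ideal.span (Set.range fun i => (MvPolynomial.X (e i) : MvPolynomial σ ℂ))) :
    maximalIdeal (LocalRingAtOrigin J) =
      Ideal.span (Set.range fun i => toLocalRingAtOrigin J (MvPolynomial.X (e i))) := by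
  have hmax := maximalIdeal_localRingAtOrigin (J := J)
  have hmap : (originIdeal σ).map (toLocalRingAtOrigin J) =
      (Ideal.span (Set.range MvPolynomial.X)).map (toLocalRingAtOrigin J) :=
    congrArg (Ideal.map (toLocalRingAtOrigin J)) originIdeal_eq_span
  rw [hmax, hmap]
  apply le_antisymm
  · rw [Ideal.map_le_iff_le_comap, Ideal.span_le]
    rintro _ ⟨s, rfl⟩
    refine (?_ : _ ≤ Ideal.comap _ _) (hgen s)
    rw [sup_le_iff]
    constructor
    · intro f hf
      rw [Ideal.mem_comap, toLocalRingAtOrigin_eq_zero hf]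
      exact zero_mem _
    · rw [Ideal.span_le]
      rintro _ ⟨i, rfl⟩
      exact Ideal.subset_span ⟨i, rfl⟩
  · rw [Ideal.span_le]
    rintro _ ⟨i, rfl⟩
    exact Ideal.mem_map_of_mem _ (Ideal.subset_span ⟨e i, rfl⟩)

/-- The map to the dual numbers is local, so membership in the maximal ideal can be tested on a
single complex number. -/
lemma fst_localEvalDual_eq_zero [IsLocalRing (LocalRingAtOrigin J)] (hJ : J ≤ originIdeal σ)
    {v : σ → ℂ} (hv : v ∈ tangentAtOrigin J) {r : LocalRingAtOrigin J} :
    (localEvalDual hJ hv r).fst = 0 ↔ r ∈ maximalIdeal (LocalRingAtOrigin J) := by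
  constructor
  · intro h
    rw [mem_maximalIdeal, mem_nonunits_iff]
    intro hr
    have := TrivSqZeroExt.isUnit_iff_isUnit_fst.mp (hr.map (localEvalDual hJ hv))
    exact this.ne_zero h
  · intro hr
    let φ : LocalRingAtOrigin J →+* ℂ :=
      (TrivSqZeroExt.fstHom ℂ ℂ ℂ).toRingHom.comp (localEvalDual hJ hv)
    refine (?_ : maximalIdeal (LocalRingAtOrigin J) ≤ RingHom.ker φ) hr
    rw [maximalIdeal_localRingAtOrigin, Ideal.map_le_iff_le_comap]
    intro f hf
    change (localEvalDual hJ hv (toLocalRingAtOrigin J f)).fst = 0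
    rw [localEvalDual_toLocal, fst_evalDual]
    exact hf

/-- The maximal ideal goes to multiples of `eps`, and `eps` has square zero. -/
lemma localEvalDual_eq_zero_of_mem_sq [IsLocalRing (LocalRingAtOrigin J)]
    (hJ : J ≤ originIdeal σ) {v : σ → ℂ} (hv : v ∈ tangentAtOrigin J) {r : LocalRingAtOrigin J}
    (hr : r ∈ maximalIdeal (LocalRingAtOrigin J) ^ 2) : localEvalDual hJ hv r = 0 := by
  refine (?_ : _ ≤ RingHom.ker (localEvalDual hJ hv)) hr
  rw [pow_two, Ideal.mul_le]
  intro a ha b hb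
  rw [← fst_localEvalDual_eq_zero hJ hv] at ha hb
  rw [RingHom.mem_ker, map_mul]
  ext <;> simp [ha, hb]

variable [Fintype ι] {v : ι → σ → ℂ}

/-- A family of generators of the maximal ideal which is independent modulo its square has as many
members as the dimension of the cotangent space. -/
lemma finrank_cotangentSpace_of_generators {R : Type*} [CommRing R] [IsLocalRing R]
    [IsNoetherianRing R] {x : ι → R} (hm : maximalIdeal R = Ideal.span (Set.range x))
    (hx : ∀ c : ι → R, ∑ i, c i * x i ∈ maximalIdeal R ^ 2 → ∀ i, c i ∈ maximalIdeal R) :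
    Module.finrank (ResidueField R) (CotangentSpace R) = Fintype.card ι := by
  have hmem (i : ι) : x i ∈ maximalIdeal R := by
    rw [hm]; exact Ideal.subset_span ⟨i, rfl⟩
  let y (i : ι) : maximalIdeal R := ⟨x i, hmem i⟩
  let z (i : ι) : CotangentSpace R := (maximalIdeal R).toCotangent (y i)
  have hli : LinearIndependent (ResidueField R) z := by
    rw [Fintype.linearIndependent_iff]
    intro g hg j
    choose c hc using fun i => IsLocalRing.residue_surjective (g i)
    have h1 : (maximalIdeal R).toCotangent (∑ i, c i • y i) = 0 := by
      rw [map_sum, ← hg]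
      refine Finset.sum_congr rfl fun i _ => ?_
      rw [map_smul, ← hc]
      rfl
    rw [Ideal.toCotangent_eq_zero] at h1
    rw [← hc, residue_eq_zero_iff]
    exact hx c (by simpa [y] using h1) j
  have hsp : Submodule.span (ResidueField R) (Set.range z) = ⊤ := by
    have : Submodule.span R (Set.range y) = ⊤ := by
      apply Submodule.map_injective_of_injective (maximalIdeal R).injective_subtype
      rw [Submodule.map_span, ← Set.range_comp, Submodule.map_top, Submodule.range_subtype]
      exact hm.symm
    rw [← IsLocalRing.CotangentSpace.span_image_eq_top_iff, ← Set.range_comp] at this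
    exact this
  exact Module.finrank_eq_card_basis (Module.Basis.mk hli hsp.ge)

/-- If there are tangent vectors dual to coordinates `e i` which generate the other ones modulo `J`,
then the cotangent space has dimension the number of these coordinates. -/
theorem finrank_cotangentSpace_localRingAtOrigin [DecidableEq ι] [Finite σ]
    [IsLocalRing (LocalRingAtOrigin J)]
    (hJ : J ≤ originIdeal σ) (hv : ∀ i, v i ∈ tangentAtOrigin J)
    (hve : ∀ i j, v i (e j) = if i = j then 1 else 0)
    (hgen : ∀ s, MvPolynomial.X s ∈
      J ⊔ Ideal.span (Set.range fun i => (MvPolynomial.X (e i) : MvPolynomial σ ℂ))) :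
    Module.finrank (ResidueField (LocalRingAtOrigin J)) (CotangentSpace (LocalRingAtOrigin J)) =
      Fintype.card ι := by
  refine finrank_cotangentSpace_of_generators (maximalIdeal_eq_span_coords hgen)
    fun c h1 j => ?_
  -- The tangent vector `v j` kills 𝔪² and sends the germ of the coordinate `e i` to δᵢⱼ `eps`, so a
  -- relation in 𝔪² isolates the constant term of `c j`.
  have h2 := localEvalDual_eq_zero_of_mem_sq hJ (hv j) h1
  have h3 := congrArg TrivSqZeroExt.snd h2
  have h4 (i : ι) : localEvalDual hJ (hv j) (toLocalRingAtOrigin J (MvPolynomial.X (e i))) =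
      TrivSqZeroExt.inr (if j = i then 1 else 0) := by
    rw [localEvalDual_toLocal, evalDual_X, hve]
  simp only [map_sum, map_mul, h4, TrivSqZeroExt.snd_sum, DualNumber.snd_mul,
    TrivSqZeroExt.snd_inr, TrivSqZeroExt.fst_inr, mul_zero, add_zero, mul_ite, mul_one,
    Finset.sum_ite_eq, Finset.mem_univ, if_true, TrivSqZeroExt.snd_zero] at h3
  rw [← fst_localEvalDual_eq_zero hJ (hv j)]
  exact h3

theorem hasTangentDimAtOrigin_of_coords [DecidableEq ι] [Finite σ]
    (hJ : J ≤ originIdeal σ) (hv : ∀ i, v i ∈ tangentAtOrigin J)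
    (hve : ∀ i j, v i (e j) = if i = j then 1 else 0)
    (hgen : ∀ s, MvPolynomial.X s ∈
      J ⊔ Ideal.span (Set.range fun i => (MvPolynomial.X (e i) : MvPolynomial σ ℂ))) :
    HasTangentDimAtOrigin J (Fintype.card ι) := by
  have := isLocalRing_localRingAtOrigin hJ
  refine ⟨this, inferInstance, ?_⟩
  rw [Subspace.dual_finrank_eq, finrank_cotangentSpace_localRingAtOrigin hJ hv hve hgen]

/-- A Noetherian local ring whose maximal ideal is generated by two elements with product zero
has dimension at most one. -/
lemma ringKrullDim_le_one_of_mul_eq_zero {S : Type*} [CommRing S] [IsLocalRing S]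
    [IsNoetherianRing S] {x y : S} (hm : maximalIdeal S = Ideal.span {x, y}) (hxy : x * y = 0) :
    ringKrullDim S ≤ 1 := by
  by_contra hcon
  have h2 : ((2 : ℕ) : WithBot ℕ∞) ≤ ringKrullDim S := by
    rw [not_le] at hcon
    exact (ENat.WithBot.add_one_le_iff (n := 1)).mpr hcon
  obtain ⟨l, hl⟩ := Order.le_krullDim_iff.mp h2
  -- Take a chain of primes p < q < r. Since xy = 0, p contains one of the generators, so S/p is a
  -- local domain with principal maximal ideal, of dimension at most one. Then q/p is a nonzero
  -- prime, hence maximal, and q = r.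
  have key (x y : S) (hm : maximalIdeal S = Ideal.span {x, y})
      (hx : x ∈ (l ⟨0, by omega⟩).asIdeal) : False := by
    set p := l ⟨0, by omega⟩
    set q := l ⟨1, by omega⟩
    have hpq : p < q := l.strictMono (by simp [Fin.lt_def])
    have hqr : q < l ⟨2, by omega⟩ := l.strictMono (by simp [Fin.lt_def])
    have hloc : IsLocalRing (S ⧸ p.asIdeal) :=
      IsLocalRing.of_surjective' _ Ideal.Quotient.mk_surjective
    have hmax : maximalIdeal (S ⧸ p.asIdeal) = Ideal.span {Ideal.Quotient.mk p.asIdeal y} := by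
      have hs : Function.Surjective (Ideal.Quotient.mk p.asIdeal) := Ideal.Quotient.mk_surjective
      have := Ideal.comap_isMaximal_of_surjective _ hs (K := maximalIdeal (S ⧸ p.asIdeal))
      rw [← Ideal.map_comap_of_surjective _ hs (maximalIdeal (S ⧸ p.asIdeal)),
        IsLocalRing.eq_maximalIdeal this, hm, Ideal.map_span, Set.image_pair,
        Ideal.Quotient.eq_zero_iff_mem.mpr hx, Ideal.span_insert_zero]
    have hdim : ringKrullDim (S ⧸ p.asIdeal) ≤ 1 := by
      refine (ringKrullDim_le_spanFinrank_maximalIdeal _).trans ?_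
      rw [hmax]
      exact_mod_cast (Submodule.spanFinrank_span_le_ncard_of_finite (Set.finite_singleton _)).trans
        (Set.ncard_singleton _).le
    have hle : Ring.KrullDimLE 1 (S ⧸ p.asIdeal) := Ring.krullDimLE_iff.mpr (by exact_mod_cast hdim)
    have hker : RingHom.ker (Ideal.Quotient.mk p.asIdeal) ≤ q.asIdeal := by
      rw [Ideal.mk_ker]; exact hpq.le
    have hq : (q.asIdeal.map (Ideal.Quotient.mk p.asIdeal)).IsPrime :=
      Ideal.map_isPrime_of_surjective Ideal.Quotient.mk_surjective hker
    have hcomap : (q.asIdeal.map (Ideal.Quotient.mk p.asIdeal)).comap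
        (Ideal.Quotient.mk p.asIdeal) = q.asIdeal := by
      rw [Ideal.comap_map_of_surjective _ Ideal.Quotient.mk_surjective]
      exact sup_eq_left.mpr hker
    have hne : q.asIdeal.map (Ideal.Quotient.mk p.asIdeal) ≠ ⊥ := by
      intro h0
      rw [h0, ← RingHom.ker_eq_comap_bot, Ideal.mk_ker] at hcomap
      exact hpq.ne (PrimeSpectrum.ext hcomap)
    have hqm := Ring.krullDimLE_one_iff_of_noZeroDivisors.mp hle _ hne hq
    have hqm' : q.asIdeal.IsMaximal := by
      rw [← hcomap]
      exact Ideal.comap_isMaximal_of_surjective _ Ideal.Quotient.mk_surjective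
    exact hqr.ne (PrimeSpectrum.ext (hqm'.eq_of_le (l ⟨2, by omega⟩).isPrime.ne_top hqr.le))
  rcases (l ⟨0, by omega⟩).isPrime.mem_or_mem (x := x) (y := y) (by rw [hxy]; exact zero_mem _) with h | h
  · exact key x y hm h
  · exact key y x (by rw [hm, Set.pair_comm]) h

/-- If a product of two distinct members of a minimal set of generators of the maximal ideal lies in
the ideal generated by the others, then the local ring is not regular. -/
lemma not_isRegularLocalRing_of_mul_mem {R : Type*} [CommRing R] [IsLocalRing R] {x : ι → R}
    (hm : maximalIdeal R = Ideal.span (Set.range x))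
    (hfin : Module.finrank (ResidueField R) (CotangentSpace R) = Fintype.card ι)
    {a b : ι} (hab : a ≠ b) (hq : x a * x b ∈ Ideal.span (x '' {a, b}ᶜ)) :
    ¬ IsRegularLocalRing R := by
  intro hreg
  have hd := (IsRegularLocalRing.iff_finrank_cotangentSpace R).mp hreg
  rw [hfin] at hd
  classical
  have hxm (i : ι) : x i ∈ maximalIdeal (R) := by
    rw [hm]; exact Ideal.subset_span ⟨i, rfl⟩
  -- The generators other than `x a` and `x b`. Dividing by `s` lowers the dimension by at most its
  -- cardinality, so at least two dimensions would have to survive.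
  let s : Finset (R) := (({a, b} : Finset ι)ᶜ).image x
  have hs : s.card + 2 ≤ Fintype.card ι := by
    have h1 : s.card ≤ _ := Finset.card_image_le
    have h2 := Finset.card_compl_add_card ({a, b} : Finset ι)
    rw [Finset.card_pair hab] at h2
    omega
  have hsm : (s : Set (R)) ⊆ maximalIdeal (R) := by
    intro r hr
    obtain ⟨i, -, rfl⟩ := Finset.mem_image.mp hr
    exact hxm i
  have hdim := ringKrullDim_le_ringKrullDim_quotient_add_card s
    (fun r hr => (IsLocalRing.ringJacobson_eq_maximalIdeal (R)).ge (hsm hr))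
  set I := Ideal.span (s : Set (R))
  have hI : I ≤ maximalIdeal (R) := Ideal.span_le.mpr hsm
  have : Nontrivial (R ⧸ I) := Ideal.Quotient.nontrivial_iff.mpr
    (ne_top_of_le_ne_top (maximalIdeal.isMaximal _).ne_top hI)
  have hmk : Function.Surjective (Ideal.Quotient.mk I) := Ideal.Quotient.mk_surjective
  have hloc' : IsLocalRing (R ⧸ I) := IsLocalRing.of_surjective' _ hmk
  have hout (i : ι) (hi : i ∉ ({a, b} : Set ι)) : x i ∈ I :=
    Ideal.subset_span (Finset.mem_coe.mpr (Finset.mem_image_of_mem x (by simpa using hi)))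
  have hmax : maximalIdeal (R ⧸ I) =
      Ideal.span {Ideal.Quotient.mk I (x a), Ideal.Quotient.mk I (x b)} := by
    have := Ideal.comap_isMaximal_of_surjective _ hmk
      (K := maximalIdeal (R ⧸ I))
    rw [← Ideal.map_comap_of_surjective _ hmk (maximalIdeal (R ⧸ I)),
      IsLocalRing.eq_maximalIdeal this, hm, Ideal.map_span]
    apply le_antisymm
    · rw [Ideal.span_le]
      rintro _ ⟨_, ⟨i, rfl⟩, rfl⟩
      by_cases hi : i ∈ ({a, b} : Set ι)
      · rcases hi with rfl | rfl
        · exact Ideal.subset_span (Set.mem_insert _ _)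
        · exact Ideal.subset_span (Set.mem_insert_of_mem _ rfl)
      · rw [Ideal.Quotient.eq_zero_iff_mem.mpr (hout i hi)]
        exact zero_mem _
    · rw [Ideal.span_le]
      rintro _ (rfl | rfl)
      · exact Ideal.subset_span ⟨_, ⟨a, rfl⟩, rfl⟩
      · exact Ideal.subset_span ⟨_, ⟨b, rfl⟩, rfl⟩
  have hxy : Ideal.Quotient.mk I (x a) * Ideal.Quotient.mk I (x b) = 0 := by
    rw [← map_mul, Ideal.Quotient.eq_zero_iff_mem]
    refine (?_ : _ ≤ I) hq
    rw [Ideal.span_le]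
    rintro _ ⟨i, hi, rfl⟩
    exact hout i hi
  have h1 := ringKrullDim_le_one_of_mul_eq_zero hmax hxy
  rw [← hd] at hdim
  have h3 : ((Fintype.card ι : ℕ) : WithBot ℕ∞) ≤ ((1 + s.card : ℕ) : WithBot ℕ∞) := by
    refine hdim.trans ?_
    push_cast
    gcongr
  have h4 : Fintype.card ι ≤ 1 + s.card := by exact_mod_cast h3
  omega

/-- Reduces non-regularity to a membership between polynomials, with no computation in the
localization. -/
theorem not_isRegularLocalRing_of_coords [DecidableEq ι] [Finite σ]
    (hJ : J ≤ originIdeal σ) (hv : ∀ i, v i ∈ tangentAtOrigin J)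
    (hve : ∀ i j, v i (e j) = if i = j then 1 else 0)
    (hgen : ∀ s, MvPolynomial.X s ∈
      J ⊔ Ideal.span (Set.range fun i => (MvPolynomial.X (e i) : MvPolynomial σ ℂ)))
    {a b : ι} (hab : a ≠ b)
    (hq : MvPolynomial.X (e a) * MvPolynomial.X (e b) ∈
      J ⊔ Ideal.span ((fun i => (MvPolynomial.X (e i) : MvPolynomial σ ℂ)) '' {a, b}ᶜ)) :
    ¬ IsRegularLocalRing (LocalRingAtOrigin J) := by
  have hloc := isLocalRing_localRingAtOrigin hJ
  refine not_isRegularLocalRing_of_mul_mem (maximalIdeal_eq_span_coords hgen)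
    (finrank_cotangentSpace_localRingAtOrigin hJ hv hve hgen) hab ?_
  rw [← map_mul]
  rw [← Ideal.mem_comap]
  refine (?_ : _ ≤ Ideal.comap (toLocalRingAtOrigin J) _) hq
  rw [sup_le_iff]
  constructor
  · intro f hf
    rw [Ideal.mem_comap, toLocalRingAtOrigin_eq_zero hf]
    exact zero_mem _
  · rw [Ideal.span_le]
    rintro _ ⟨i, hi, rfl⟩
    exact Ideal.subset_span ⟨i, hi, rfl⟩

end LocalRing

/-! ### Cartan subalgebras of `𝔰𝔩ₙ` -/

section Cartan

open LieModule

variable {n : ℕ}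

lemma exists_GL_mulVec {ι : Type*} [Fintype ι] [DecidableEq ι] (e : (ι → ℂ) ≃ₗ[ℂ] (ι → ℂ)) :
    ∃ g : GL ι ℂ, (∀ v, g.val *ᵥ v = e v) ∧ ∀ v, g⁻¹.val *ᵥ v = e.symm v := by
  have h1 : LinearMap.toMatrix' e.toLinearMap * LinearMap.toMatrix' e.symm.toLinearMap = 1 := by
    rw [← LinearMap.toMatrix'_comp]; simp
  have h2 : LinearMap.toMatrix' e.symm.toLinearMap * LinearMap.toMatrix' e.toLinearMap = 1 := by
    rw [← LinearMap.toMatrix'_comp]; simp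
  exact ⟨⟨_, _, h1, h2⟩, fun v => LinearMap.toMatrix'_mulVec _ _,
    fun v => LinearMap.toMatrix'_mulVec _ _⟩

/-- Conjugation by an invertible matrix, as an automorphism of `𝔰𝔩ₙ`. -/
def conjSl (g : GL (Fin n) ℂ) : Sl n ≃ₗ⁅ℂ⁆ Sl n where
  toFun X := ⟨g.val * X.val * g⁻¹.val, by
    have hX : X.val.trace = 0 := X.2
    change (g.val * X.val * g⁻¹.val).trace = 0
    rw [Matrix.trace_mul_comm, ← mul_assoc, Units.inv_mul, one_mul, hX]⟩
  invFun X := ⟨g⁻¹.val * X.val * g.val, by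
    have hX : X.val.trace = 0 := X.2
    change (g⁻¹.val * X.val * g.val).trace = 0
    rw [Matrix.trace_mul_comm, ← mul_assoc, Units.mul_inv, one_mul, hX]⟩
  map_add' X Y := Subtype.ext (by simp [mul_add, add_mul])
  map_smul' c X := Subtype.ext (by simp)
  map_lie' {X Y} := by
    apply Subtype.ext
    have h : g⁻¹.val * g.val = 1 := Units.inv_mul g
    simp only [LieAlgebra.SpecialLinear.sl_bracket, mul_sub, sub_mul]
    congr 1 <;> simp only [mul_assoc] <;> simp only [← mul_assoc g⁻¹.val g.val, h, one_mul]
  left_inv X := Subtype.ext (by simp [mul_assoc])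
  right_inv X := Subtype.ext (by simp [mul_assoc])

@[simp] lemma conjSl_val (g : GL (Fin n) ℂ) (X : Sl n) :
    (conjSl g X).val = g.val * X.val * g⁻¹.val := rfl

lemma conjSl_symm (g : GL (Fin n) ℂ) : (conjSl g).symm = conjSl g⁻¹ := by
  ext X : 1
  apply Subtype.ext
  change g⁻¹.val * X.val * g.val = _
  simp

/-- The traceless diagonal matrices. -/
def diagSl (n : ℕ) : LieSubalgebra ℂ (Sl n) where
  carrier := {X | X.val.IsDiag}
  zero_mem' := Matrix.isDiag_zero
  add_mem' hX hY := hX.add hY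
  smul_mem' c _ hX := hX.smul c
  lie_mem' {X Y} hX hY := by
    change Matrix.IsDiag (X.val * Y.val - Y.val * X.val)
    rw [← Matrix.IsDiag.diagonal_diag hX, ← Matrix.IsDiag.diagonal_diag hY, diagonal_mul_diagonal,
      diagonal_mul_diagonal]
    exact (Matrix.isDiag_diagonal _).sub (Matrix.isDiag_diagonal _)

lemma mem_diagSl {X : Sl n} : X ∈ diagSl n ↔ X.val.IsDiag := Iff.rfl

lemma lie_eq_zero_of_mem_diagSl {X Y : Sl n} (hX : X ∈ diagSl n) (hY : Y ∈ diagSl n) :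
    ⁅X, Y⁆ = 0 := by
  apply Subtype.ext
  rw [LieAlgebra.SpecialLinear.sl_bracket]
  rw [mem_diagSl] at hX hY
  rw [← Matrix.IsDiag.diagonal_diag hX, ← Matrix.IsDiag.diagonal_diag hY, diagonal_mul_diagonal,
      diagonal_mul_diagonal]
  simp [mul_comm]

instance diagSl_isCartanSubalgebra : (diagSl n).IsCartanSubalgebra where
  nilpotent := by
    have : IsLieAbelian (diagSl n) :=
      ⟨fun X Y => Subtype.ext (lie_eq_zero_of_mem_diagSl X.2 Y.2)⟩
    infer_instance
  self_normalizing := by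
    refine le_antisymm (fun X hX => ?_) (LieSubalgebra.le_normalizer _)
    rw [LieSubalgebra.mem_normalizer_iff] at hX
    intro i j hij
    -- The (i, j) entry of [X, Eᵢᵢ - Eⱼⱼ] is -2 Xᵢⱼ, and it must be zero.
    let D : Sl n := LieAlgebra.SpecialLinear.singleSubSingle i j 1
    have hD : D.val = Matrix.diagonal (Pi.single i 1 - Pi.single j 1) := by
      simp only [D, LieAlgebra.SpecialLinear.val_singleSubSingle]
      ext a b
      simp [Matrix.single_apply, Matrix.diagonal_apply, Pi.single_apply]
      grind
    have h := hX D (by rw [mem_diagSl, hD]; exact Matrix.isDiag_diagonal _) hij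
    rw [LieAlgebra.SpecialLinear.sl_bracket, hD, Matrix.sub_apply, mul_diagonal, diagonal_mul] at h
    simp [hij, hij.symm] at h
    have h2 : (-2 : ℂ) * X.val i j = 0 := by linear_combination h
    simpa using h2

lemma isCartanSubalgebra_map (θ : Sl n ≃ₗ⁅ℂ⁆ Sl n) (H : LieSubalgebra ℂ (Sl n))
    [H.IsCartanSubalgebra] : (H.map θ.toLieHom).IsCartanSubalgebra where
  nilpotent := (LieEquiv.nilpotent_iff_equiv_nilpotent (LieEquiv.lieSubalgebraMap H θ)).mp
    inferInstance
  self_normalizing := by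
    refine le_antisymm (fun X hX => ?_) (LieSubalgebra.le_normalizer _)
    rw [LieSubalgebra.mem_normalizer_iff] at hX
    refine ⟨θ.symm X, ?_, θ.apply_symm_apply X⟩
    change _ ∈ H
    rw [← LieSubalgebra.IsCartanSubalgebra.self_normalizing (H := H),
      LieSubalgebra.mem_normalizer_iff]
    intro Y hY
    obtain ⟨Z, hZ, hZ'⟩ := hX (θ Y) ⟨Y, hY, rfl⟩
    have : Z = ⁅θ.symm X, Y⁆ := by
      apply θ.injective
      have h1 : θ ⁅θ.symm X, Y⁆ = ⁅X, θ Y⁆ := by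
        rw [← LieEquiv.coe_toLieHom, LieHom.map_lie, LieEquiv.coe_toLieHom, θ.apply_symm_apply]
      exact hZ'.trans h1.symm
    rw [← this]
    exact hZ

/-- A Cartan subalgebra which is block diagonal with scalar plus nilpotent blocks, for the partition
of the indices given by `κ`, consists of the traceless diagonal matrices. -/
lemma eq_diagSl_of_blocks {K : Type*} {κ : Fin n → K} (H : LieSubalgebra ℂ (Sl n))
    [H.IsCartanSubalgebra] (hblock : ∀ h ∈ H, ∀ i j, κ i ≠ κ j → h.val i j = 0)
    (hnil : ∀ h ∈ H, ∃ d : K → ℂ, IsNilpotent (h.val - diagonal (d ∘ κ))) : H = diagSl n := by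
  -- A block diagonal `X` commutes with the scalar part of each `h` in `H`, so ad h acts on it as ad
  -- of a nilpotent matrix. Hence `X` is in the zero root space, which is `H` itself.
  have hmem (X : Sl n) (hX : ∀ i j, κ i ≠ κ j → X.val i j = 0) : X ∈ H := by
    rw [← LieAlgebra.zeroRootSubalgebra_eq_of_is_cartan ℂ (Sl n) H,
      LieAlgebra.mem_zeroRootSubalgebra]
    intro y
    obtain ⟨d, hd⟩ := hnil y y.2
    obtain ⟨k, hk⟩ := LieAlgebra.ad_nilpotent_of_nilpotent (R := ℂ) hd
    refine ⟨k, ?_⟩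
    have key (k : ℕ) : ∀ Z : Sl n, (∀ i j, κ i ≠ κ j → Z.val i j = 0) →
        ((toEnd ℂ H (Sl n) y ^ k) Z).val =
          (LieAlgebra.ad ℂ (Matrix (Fin n) (Fin n) ℂ) (y.1.val - diagonal (d ∘ κ)) ^ k) Z.val := by
      induction k with
      | zero => intro Z _; simp
      | succ k ih =>
        intro Z hZ
        have hyZ : (⁅y, Z⁆ : Sl n).val = y.1.val * Z.val - Z.val * y.1.val := rfl
        rw [pow_succ, pow_succ, Module.End.mul_apply, Module.End.mul_apply, toEnd_apply_apply, ih]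
        · congr 1
          rw [hyZ, LieAlgebra.ad_apply, Ring.lie_def]
          have : diagonal (d ∘ κ) * Z.val = Z.val * diagonal (d ∘ κ) := by
            ext i j
            rw [diagonal_mul, mul_diagonal]
            by_cases h : κ i = κ j
            · simp [h, mul_comm]
            · simp [hZ i j h]
          rw [sub_mul, mul_sub, this]
          abel
        · intro i j hij
          rw [hyZ, Matrix.sub_apply, mul_apply, mul_apply, sub_eq_zero]
          trans 0
          · refine Finset.sum_eq_zero fun l _ => ?_
            by_cases h : κ i = κ l
            · rw [hZ l j (h ▸ hij), mul_zero]
            · rw [hblock _ y.2 i l h, zero_mul]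
          · symm
            refine Finset.sum_eq_zero fun l _ => ?_
            by_cases h : κ i = κ l
            · rw [hblock _ y.2 l j (h ▸ hij), mul_zero]
            · rw [hZ i l h, zero_mul]
    exact Subtype.ext (by rw [key k X hX, hk]; rfl)
  -- Two indices in one block would put Eᵢⱼ and Eⱼᵢ in `H`, and [[E, F], E] = 2E contradicts the
  -- nilpotency of `H`.
  have hinj : Function.Injective κ := by
    intro i j hij
    by_contra hne
    have hE : LieAlgebra.SpecialLinear.single i j hne (1 : ℂ) ∈ H := hmem _ fun a b hab => by
      rw [LieAlgebra.SpecialLinear.val_single, single_apply]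
      grind
    have hF : LieAlgebra.SpecialLinear.single j i (Ne.symm hne) (1 : ℂ) ∈ H :=
      hmem _ fun a b hab => by
        rw [LieAlgebra.SpecialLinear.val_single, single_apply]
        grind
    let E : H := ⟨_, hE⟩
    let F : H := ⟨_, hF⟩
    have h2 : ⁅⁅E, F⁆, E⁆ = (2 : ℂ) • E := by
      apply Subtype.ext
      apply Subtype.ext
      change (Matrix.single i j (1 : ℂ) * Matrix.single j i 1
        - Matrix.single j i 1 * Matrix.single i j 1) * Matrix.single i j 1 - Matrix.single i j 1 *
        (Matrix.single i j 1 * Matrix.single j i 1 - Matrix.single j i 1 * Matrix.single i j 1) =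
        (2 : ℂ) • Matrix.single i j 1
      simp [sub_mul, mul_sub, Ne.symm hne, two_smul]
    obtain ⟨k, hk⟩ := isNilpotent_toEnd_of_isNilpotent ℂ H H ⁅E, F⁆
    have h3 (k : ℕ) : (toEnd ℂ H H ⁅E, F⁆ ^ k) E = (2 : ℂ) ^ k • E := by
      induction k with
      | zero => simp
      | succ k ih => rw [pow_succ, Module.End.mul_apply, toEnd_apply_apply, h2, map_smul, ih,
          smul_smul, pow_succ, mul_comm]
    have h4 := h3 k
    rw [hk, LinearMap.zero_apply, eq_comm, smul_eq_zero] at h4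
    rcases h4 with h4 | h4
    · exact absurd h4 (by simp)
    · have := congrFun (congrFun (congrArg (fun x : H => x.1.val) h4) i) j
      simp [E] at this
  ext X
  refine ⟨fun hX i j hij => hblock X hX i j (hinj.ne hij), fun hX => hmem X fun i j hij => ?_⟩
  exact hX fun h => hij (h ▸ rfl)

/-- Every Cartan subalgebra of `𝔰𝔩ₙ` is conjugate to the subalgebra of diagonal matrices. -/
theorem exists_eq_map_diagSl (H : LieSubalgebra ℂ (Sl n)) [H.IsCartanSubalgebra] :
    ∃ g : GL (Fin n) ℂ, H = (diagSl n).map (conjSl g).toLieHom := by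
  classical
  let V := Fin n → ℂ
  -- ℂⁿ is the direct sum of its generalized weight spaces under the nilpotent algebra `H`. In a
  -- basis adapted to this sum each `h` has one scalar plus nilpotent block per weight.
  let A (χ : Weight ℂ H V) : Submodule ℂ V := (genWeightSpace V χ).toSubmodule
  have hA : DirectSum.IsInternal A := by
    apply DirectSum.isInternal_submodule_of_iSupIndep_of_iSup_eq_top
    · exact LieSubmodule.iSupIndep_toSubmodule.mpr (iSupIndep_genWeightSpace' ℂ H V)
    · rw [← LieSubmodule.iSup_toSubmodule, iSup_genWeightSpace_eq_top' ℂ H V]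
      rfl
  let b₀ := hA.collectedBasis fun χ => Module.finBasis ℂ (A χ)
  let ε := Fintype.equivOfCardEq (((Module.finrank_eq_card_basis b₀).symm.trans
    (Module.finrank_fin_fun ℂ)).trans (Fintype.card_fin n).symm)
  let b := b₀.reindex ε
  let κ (i : Fin n) : Weight ℂ H V := (ε.symm i).1
  have hb (i : Fin n) : b i ∈ A (κ i) := by
    rw [Module.Basis.reindex_apply]
    exact hA.collectedBasis_mem _ _
  have hrepr {χ : Weight ℂ H V} {x : V} (hx : x ∈ A χ) {i : Fin n} (hi : κ i ≠ χ) :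
      b.equivFun x i = 0 := by
    rw [Module.Basis.equivFun_apply, Module.Basis.repr_reindex_apply]
    exact hA.collectedBasis_repr_of_mem_ne _ (Ne.symm hi) hx
  obtain ⟨g, hg, hg'⟩ := exists_GL_mulVec b.equivFun.symm
  rw [LinearEquiv.symm_symm] at hg'
  have hcart := isCartanSubalgebra_map (conjSl g⁻¹) H
  have hcol (h : H) {χ : Weight ℂ H V} {x : V} (hx : x ∈ A χ) :
      (conjSl g⁻¹ h.1).val *ᵥ b.equivFun x = b.equivFun (h.1.val *ᵥ x) := by
    rw [conjSl_val, inv_inv, ← mulVec_mulVec, hg, LinearEquiv.symm_apply_apply, ← mulVec_mulVec,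
      hg']
  have hstab (h : H) {χ : Weight ℂ H V} {x : V} (hx : x ∈ A χ) : h.1.val *ᵥ x ∈ A χ :=
    (genWeightSpace V χ).lie_mem (x := h) hx
  have hsingle (j : Fin n) : b.equivFun (b j) = Pi.single j 1 := by
    ext i
    simp [Pi.single_apply, eq_comm]
  have key : H.map (conjSl g⁻¹).toLieHom = diagSl n := by
    refine eq_diagSl_of_blocks (κ := κ) _ ?_ ?_
    · rintro _ ⟨h, hh, rfl⟩ i j hij
      have h1 := hcol ⟨h, hh⟩ (hb j)
      have h2 := hrepr (hstab ⟨h, hh⟩ (hb j)) hij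
      rw [← h1, hsingle] at h2
      simpa using h2
    · rintro _ ⟨h, hh, rfl⟩
      refine ⟨fun χ => χ ⟨h, hh⟩, ?_⟩
      set N := (conjSl g⁻¹ h).val - diagonal ((fun χ : Weight ℂ H V => χ ⟨h, hh⟩) ∘ κ)
      -- On the coordinates of the weight space of χ, `N` acts as h - χ(h), which is nilpotent
      -- there.
      have hN {χ : Weight ℂ H V} (k : ℕ) : ∀ {x : V}, x ∈ A χ → (toLin' N ^ k) (b.equivFun x) =
          b.equivFun (((toEnd ℂ H V ⟨h, hh⟩ - algebraMap ℂ (Module.End ℂ V) (χ ⟨h, hh⟩)) ^ k) x) := by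
        induction k with
        | zero => intro x _; simp
        | succ k ih =>
          intro x hx
          have h1 : toLin' N (b.equivFun x) = b.equivFun
              ((toEnd ℂ H V ⟨h, hh⟩ - algebraMap ℂ (Module.End ℂ V) (χ ⟨h, hh⟩)) x) := by
            rw [toLin'_apply, sub_mulVec, hcol ⟨h, hh⟩ hx, LinearMap.sub_apply, map_sub]
            congr 1
            ext i
            rw [mulVec_diagonal, Module.algebraMap_end_apply, map_smul, Pi.smul_apply, smul_eq_mul]
            by_cases hi : κ i = χ
            · simp [hi]
            · simp only [hrepr hx hi, mul_zero]
          rw [pow_succ, pow_succ, Module.End.mul_apply, Module.End.mul_apply, h1, ih]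
          exact (A χ).sub_mem (hstab ⟨h, hh⟩ hx) ((A χ).smul_mem _ hx)
      have htop : Module.End.maxGenEigenspace (toLin' N) 0 = ⊤ := by
        rw [eq_top_iff, ← (Pi.basisFun ℂ (Fin n)).span_eq, Submodule.span_le]
        rintro _ ⟨j, rfl⟩
        obtain ⟨k, hk⟩ := exists_genWeightSpace_le_ker_of_isNoetherian V (κ j) (⟨h, hh⟩ : H)
        rw [SetLike.mem_coe, Module.End.mem_maxGenEigenspace]
        refine ⟨k, ?_⟩
        have h2 : ((toEnd ℂ H V ⟨h, hh⟩ - algebraMap ℂ (Module.End ℂ V) (κ j ⟨h, hh⟩)) ^ k) (b j) = 0 :=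
          hk (hb j)
        rw [zero_smul, sub_zero, Pi.basisFun_apply, ← hsingle, hN k (hb j), h2, map_zero]
      have hnil : IsNilpotent (toLin' N) := by
        rw [Module.End.isNilpotent_iff_of_finite]
        intro m
        have : m ∈ Module.End.maxGenEigenspace (toLin' N) 0 := htop ▸ Submodule.mem_top
        simpa using Module.End.mem_maxGenEigenspace _ _ _ |>.mp this
      exact (isNilpotent_toLin'_iff N).mp hnil
  refine ⟨g, ?_⟩
  rw [← key]
  ext X
  constructor
  · intro hX
    exact ⟨_, ⟨X, hX, rfl⟩, (by simpa [conjSl_symm] using (conjSl g).apply_symm_apply X)⟩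
  · rintro ⟨_, ⟨Y, hY, rfl⟩, rfl⟩
    have : (conjSl g) (conjSl g⁻¹ Y) = Y := by
      simpa [conjSl_symm] using (conjSl g).apply_symm_apply Y
    change conjSl g (conjSl g⁻¹ Y) ∈ H
    rwa [this]

end Cartan

/-! ### Charts and closures in the Grassmannian -/

section Grassmannian

variable {V : Type*} [AddCommGroup V] [Module ℂ V] {k m : ℕ}

lemma finrank_grChart (b : Module.Basis (Fin k ⊕ Fin m) ℂ V) (x : Fin k × Fin m → ℂ) :
    Module.finrank ℂ (grChart b x) = k := by
  have hli : LinearIndependent ℂ fun i => b (Sum.inl i) + ∑ j, x (i, j) • b (Sum.inr j) := by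
    let L : V →ₗ[ℂ] (Fin k → ℂ) := LinearMap.pi fun i => b.coord (Sum.inl i)
    apply LinearIndependent.of_comp L
    convert (Pi.basisFun ℂ (Fin k)).linearIndependent with i
    ext j
    simp [L, Pi.single_apply, Finsupp.single_apply, eq_comm]
  rw [grChart, finrank_span_eq_card hli, Fintype.card_fin]

lemma grChart_map (b : Module.Basis (Fin k ⊕ Fin m) ℂ V) (θ : V ≃ₗ[ℂ] V)
    (x : Fin k × Fin m → ℂ) :
    grChart (b.map θ) x = (grChart b x).map θ.toLinearMap := by
  rw [grChart, grChart, Submodule.map_span, ← Set.range_comp]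
  congr 2
  ext i
  simp

/-- Translating a chart by a symmetry of `Z` does not change the polynomials, so a computation at
one point serves for its whole orbit. -/
lemma chartIdeal_map (b : Module.Basis (Fin k ⊕ Fin m) ℂ V) (θ : V ≃ₗ[ℂ] V)
    {Z : Set (Submodule ℂ V)} (hZ : ∀ W, W.map θ.toLinearMap ∈ Z ↔ W ∈ Z) :
    chartIdeal (b.map θ) Z = chartIdeal b Z := by
  rw [chartIdeal, chartIdeal]
  congr 1
  ext x
  rw [Set.mem_preimage, Set.mem_preimage, grChart_map, hZ]

lemma IsGrClosed.preimage_map {Z : Set (Submodule ℂ V)} (hZ : IsGrClosed k m Z)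
    (θ : V ≃ₗ[ℂ] V) : IsGrClosed k m {W | W.map θ.toLinearMap ∈ Z} := by
  refine ⟨fun W hW => ?_, fun b => ?_⟩
  · have := hZ.1 hW
    rw [grassmannian, Set.mem_ofPred_eq] at this ⊢
    rw [← this]
    exact (θ.finrank_map_eq W).symm
  · obtain ⟨I, hI⟩ := hZ.2 (b.map θ)
    refine ⟨I, ?_⟩
    rw [← hI]
    ext x
    rw [Set.mem_preimage, Set.mem_preimage, grChart_map]
    rfl

lemma map_mem_grClosure {S : Set (Submodule ℂ V)} (θ : V ≃ₗ[ℂ] V)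
    (hS : ∀ W ∈ S, W.map θ.toLinearMap ∈ S) {W : Submodule ℂ V} (hW : W ∈ grClosure k m S) :
    W.map θ.toLinearMap ∈ grClosure k m S := by
  rintro Z ⟨hZ, hSZ⟩
  exact hW _ ⟨hZ.preimage_map θ, fun W' hW' => hSZ (hS W' hW')⟩

/-- If infinitely many points of an affine line in a chart belong to a set, then all its points
belong to the closure of the set. -/
lemma grChart_mem_grClosure {S : Set (Submodule ℂ V)} (b : Module.Basis (Fin k ⊕ Fin m) ℂ V)
    (x y : Fin k × Fin m → ℂ) (h : {s : ℂ | grChart b (x + s • y) ∈ S}.Infinite) :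
    grChart b x ∈ grClosure k m S := by
  rintro Z ⟨hZ, hSZ⟩
  obtain ⟨I, hI⟩ := hZ.2 b
  change x ∈ grChart b ⁻¹' Z
  rw [hI, MvPolynomial.mem_zeroLocus_iff]
  intro f hf
  set g : Polynomial ℂ :=
    MvPolynomial.aeval (fun t => Polynomial.C (x t) + Polynomial.C (y t) * Polynomial.X) f
  have heval (s : ℂ) : g.eval s = MvPolynomial.aeval (x + s • y) f := by
    have h1 : (Polynomial.aeval s : Polynomial ℂ →ₐ[ℂ] ℂ).comp
        (MvPolynomial.aeval fun t => Polynomial.C (x t) + Polynomial.C (y t) * Polynomial.X) =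
        MvPolynomial.aeval (x + s • y) := by
      refine MvPolynomial.algHom_ext fun t => ?_
      simp only [AlgHom.comp_apply, MvPolynomial.aeval_X, map_mul, map_add, Polynomial.aeval_X,
        Polynomial.aeval_C, Pi.add_apply, Pi.smul_apply, smul_eq_mul, Algebra.algebraMap_self,
        RingHom.id_apply, mul_comm]
    rw [← h1, AlgHom.comp_apply, Polynomial.coe_aeval_eq_eval]
  have hg : g = 0 := by
    refine Polynomial.eq_zero_of_infinite_isRoot g (h.mono fun s hs => ?_)
    rw [Set.mem_ofPred_eq, Polynomial.IsRoot.def, heval]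
    have : x + s • y ∈ grChart b ⁻¹' Z := hSZ hs
    rw [hI, MvPolynomial.mem_zeroLocus_iff] at this
    exact this f hf
  have := heval 0
  rwa [hg, Polynomial.eval_zero, zero_smul, add_zero, eq_comm] at this

end Grassmannian

/-! ### The variety of abelian subalgebras and the variety of reductions -/

section Varieties

variable {n k m : ℕ}

lemma universalFrame_map_eval (b : Module.Basis (Fin k ⊕ Fin m) ℂ (Sl n))
    (x : Fin k × Fin m → ℂ) (i : Fin k) :
    (universalFrame b i).map (MvPolynomial.eval x) =
      (b (Sum.inl i) + ∑ j, x (i, j) • b (Sum.inr j) : Sl n).val := by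
  ext p q
  simp [universalFrame, Matrix.sum_apply]

lemma eval_commutator_universalFrame (b : Module.Basis (Fin k ⊕ Fin m) ℂ (Sl n))
    (x : Fin k × Fin m → ℂ) (i j : Fin k) (p q : Fin n) :
    MvPolynomial.eval x ((universalFrame b i * universalFrame b j -
      universalFrame b j * universalFrame b i) p q) =
    ⁅b (Sum.inl i) + ∑ l, x (i, l) • b (Sum.inr l),
      b (Sum.inl j) + ∑ l, x (j, l) • b (Sum.inr l)⁆.val p q := by
  rw [LieAlgebra.SpecialLinear.sl_bracket, ← universalFrame_map_eval, ← universalFrame_map_eval,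
    ← Matrix.map_mul, ← Matrix.map_mul, Matrix.sub_apply, map_sub]
  rfl

lemma zeroLocus_abSchemeIdeal (b : Module.Basis (Fin (n - 1) ⊕ Fin m) ℂ (Sl n)) :
    grChart b ⁻¹' AbVar n = MvPolynomial.zeroLocus ℂ (abSchemeIdeal b) := by
  ext x
  rw [abSchemeIdeal, MvPolynomial.zeroLocus_span]
  constructor
  · rintro ⟨-, h⟩ _ ⟨i, j, p, q, rfl⟩
    rw [MvPolynomial.aeval_eq_eval, eval_commutator_universalFrame, h]
    · rfl
    · exact Submodule.subset_span ⟨i, rfl⟩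
    · exact Submodule.subset_span ⟨j, rfl⟩
  · intro h
    refine ⟨finrank_grChart b x, fun X hX Y hY => ?_⟩
    induction hX, hY using Submodule.span_induction₂ with
    | mem_mem X Y hX hY =>
      obtain ⟨i, rfl⟩ := hX
      obtain ⟨j, rfl⟩ := hY
      apply Subtype.ext
      ext p q
      have := h _ ⟨i, j, p, q, rfl⟩
      rw [MvPolynomial.aeval_eq_eval, eval_commutator_universalFrame] at this
      exact this
    | zero_left => simp
    | zero_right => simp
    | add_left X Y Z _ _ _ h1 h2 => rw [add_lie, h1, h2, add_zero]
    | add_right X Y Z _ _ _ h1 h2 => rw [lie_add, h1, h2, add_zero]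
    | smul_left c X Y _ _ h1 => rw [smul_lie, h1, smul_zero]
    | smul_right c X Y _ _ h1 => rw [lie_smul, h1, smul_zero]

lemma isGrClosed_abVar (n m : ℕ) : IsGrClosed (n - 1) m (AbVar n) :=
  ⟨fun _ h => h.1, fun b => ⟨_, zeroLocus_abSchemeIdeal b⟩⟩

lemma abSchemeIdeal_le_chartIdeal (b : Module.Basis (Fin (n - 1) ⊕ Fin m) ℂ (Sl n)) :
    abSchemeIdeal b ≤ chartIdeal b (AbVar n) := by
  rw [chartIdeal, zeroLocus_abSchemeIdeal]
  exact MvPolynomial.le_vanishingIdeal_zeroLocus _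

/-- The coefficients of the universal frame with respect to the basis defining a chart. -/
def frameCoeff (k m : ℕ) (i : Fin k) : Fin k ⊕ Fin m → MvPolynomial (Fin k × Fin m) ℂ
  | Sum.inl j => if j = i then 1 else 0
  | Sum.inr j => MvPolynomial.X (i, j)

lemma commutator_sum_smul {ι R : Type*} [Fintype ι] [CommRing R] (y z : ι → R)
    (A : ι → Matrix (Fin n) (Fin n) R) (p q : Fin n) :
    ((∑ a, y a • A a) * (∑ c, z c • A c) - (∑ c, z c • A c) * (∑ a, y a • A a)) p q =
      ∑ a, ∑ c, y a * z c * (A a * A c - A c * A a) p q := by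
  rw [Finset.sum_mul_sum, Finset.sum_mul_sum, Finset.sum_comm (γ := ι) (s := Finset.univ)
    (f := fun c a => z c • A c * y a • A a), ← Finset.sum_sub_distrib]
  simp only [← Finset.sum_sub_distrib, Matrix.sum_apply]
  refine Finset.sum_congr rfl fun a _ => Finset.sum_congr rfl fun c _ => ?_
  simp only [Matrix.smul_mul, Matrix.mul_smul, Matrix.sub_apply, Matrix.smul_apply, smul_eq_mul]
  ring

lemma commutator_universalFrame (b : Module.Basis (Fin k ⊕ Fin m) ℂ (Sl n)) (i j : Fin k)
    (p q : Fin n) :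
    (universalFrame b i * universalFrame b j - universalFrame b j * universalFrame b i) p q =
      ∑ a, ∑ c, frameCoeff k m i a * frameCoeff k m j c *
        MvPolynomial.C (⁅b a, b c⁆.val p q) := by
  have h (i : Fin k) : universalFrame b i =
      ∑ a, frameCoeff k m i a • (b a).val.map (MvPolynomial.C (σ := Fin k × Fin m)) := by
    simp [universalFrame, frameCoeff, Fintype.sum_sum_type]
  rw [h, h, commutator_sum_smul]
  refine Finset.sum_congr rfl fun a _ => Finset.sum_congr rfl fun c _ => ?_
  rw [← Matrix.map_mul, ← Matrix.map_mul, LieAlgebra.SpecialLinear.sl_bracket, Matrix.sub_apply,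
    Matrix.sub_apply, map_sub]
  rfl

lemma abSchemeIdeal_le_map (b : Module.Basis (Fin k ⊕ Fin m) ℂ (Sl n)) (θ : Sl n ≃ₗ⁅ℂ⁆ Sl n) :
    abSchemeIdeal b ≤ abSchemeIdeal (b.map θ.toLinearEquiv) := by
  rw [abSchemeIdeal, Ideal.span_le]
  rintro _ ⟨i, j, p, q, rfl⟩
  let φ : Sl n →ₗ[ℂ] ℂ := (Matrix.entryLinearMap ℂ ℂ p q).comp
    ((Sl n).toSubmodule.subtype.comp θ.symm.toLinearEquiv.toLinearMap)
  -- Extending the functional X ↦ (θ⁻¹X) p q from 𝔰𝔩ₙ to all matrices writes it as a combination of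
  -- matrix entries with constant coefficients. The equations of the old chart thus become
  -- combinations of those of the new one.
  obtain ⟨ψ, hψ⟩ := LinearMap.exists_extend (p := (Sl n).toSubmodule) φ
  have hψ' (X : Sl n) : (θ.symm X).val p q = ∑ r, ∑ s, X.val r s * ψ (Matrix.single r s 1) := by
    have h1 : ψ X.val = (θ.symm X).val p q := DFunLike.congr_fun hψ X
    rw [← h1]
    conv_lhs => rw [Matrix.matrix_eq_sum_single X.val]
    simp only [map_sum]
    refine Finset.sum_congr rfl fun r _ => Finset.sum_congr rfl fun s _ => ?_
    rw [← smul_eq_mul, ← map_smul, Matrix.smul_single, smul_eq_mul, mul_one]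
  have key : (universalFrame b i * universalFrame b j - universalFrame b j * universalFrame b i) p q =
      ∑ r, ∑ s, MvPolynomial.C (ψ (Matrix.single r s 1)) *
        (universalFrame (b.map θ.toLinearEquiv) i * universalFrame (b.map θ.toLinearEquiv) j -
          universalFrame (b.map θ.toLinearEquiv) j * universalFrame (b.map θ.toLinearEquiv) i) r s := by
    simp only [commutator_universalFrame, Finset.mul_sum]
    have h1 (a c : Fin k ⊕ Fin m) : ⁅b a, b c⁆.val p q = ∑ r, ∑ s,
        ⁅b.map θ.toLinearEquiv a, b.map θ.toLinearEquiv c⁆.val r s * ψ (Matrix.single r s 1) := by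
      have h2 : θ.symm ⁅b.map θ.toLinearEquiv a, b.map θ.toLinearEquiv c⁆ = ⁅b a, b c⁆ := by
        apply θ.injective
        exact (θ.apply_symm_apply _).trans (LieHom.map_lie θ.toLieHom (b a) (b c)).symm
      rw [← hψ', h2]
    simp only [h1, map_sum, Finset.mul_sum, map_mul]
    rw [Finset.sum_congr rfl fun a _ => Finset.sum_comm]
    rw [Finset.sum_comm]
    refine Finset.sum_congr rfl fun r _ => ?_
    rw [Finset.sum_congr rfl fun a _ => Finset.sum_comm]
    rw [Finset.sum_comm]
    refine Finset.sum_congr rfl fun s _ => Finset.sum_congr rfl fun a _ =>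
      Finset.sum_congr rfl fun c _ => ?_
    ring
  rw [key]
  refine Ideal.sum_mem _ fun r _ => Ideal.sum_mem _ fun s _ => Ideal.mul_mem_left _ _ ?_
  exact Ideal.subset_span ⟨i, j, r, s, rfl⟩

lemma finrank_diagSl (n : ℕ) : Module.finrank ℂ (diagSl n) = n - 1 := by
  let φ : Module.Dual ℂ (Fin n → ℂ) := ∑ i, LinearMap.proj i
  have hφ (v : Fin n → ℂ) : φ v = ∑ i, v i := by simp [φ]
  let e : diagSl n ≃ₗ[ℂ] LinearMap.ker φ :=
    { toFun X := ⟨X.1.val.diag, by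
        rw [LinearMap.mem_ker, hφ]
        exact X.1.2⟩
      invFun v := ⟨⟨diagonal v.1, by
        have := v.2
        rw [LinearMap.mem_ker, hφ] at this
        exact (Matrix.trace_diagonal _).trans this⟩, Matrix.isDiag_diagonal _⟩
      map_add' X Y := rfl
      map_smul' c X := rfl
      left_inv X := Subtype.ext (Subtype.ext (Matrix.IsDiag.diagonal_diag X.2))
      right_inv v := Subtype.ext (Matrix.diag_diagonal _) }
  rw [e.finrank_eq]
  rcases Nat.eq_zero_or_pos n with rfl | hn
  · exact Module.finrank_zero_of_subsingleton
  · have hne : φ ≠ 0 := fun h => by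
      have := hφ (Pi.single ⟨0, hn⟩ 1)
      simp [h] at this
    have := Module.Dual.finrank_ker_add_one_of_ne_zero hne
    rw [Module.finrank_fin_fun] at this
    omega

lemma red₀_subset_abVar (n : ℕ) : Red₀ n ⊆ AbVar n := by
  rintro _ ⟨H, hH, rfl⟩
  obtain ⟨g, rfl⟩ := exists_eq_map_diagSl H
  refine ⟨?_, ?_⟩
  · rw [grassmannian, Set.mem_ofPred_eq, ← finrank_diagSl n]
    exact ((conjSl g).toLinearEquiv.finrank_map_eq (diagSl n).toSubmodule)
  · rintro _ ⟨X, hX, rfl⟩ _ ⟨Y, hY, rfl⟩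
    change ⁅(conjSl g).toLieHom X, (conjSl g).toLieHom Y⁆ = 0
    rw [← LieHom.map_lie, lie_eq_zero_of_mem_diagSl hX hY, map_zero]

lemma red_subset_abVar (n : ℕ) : Red n ⊆ AbVar n :=
  Set.sInter_subset_of_mem ⟨isGrClosed_abVar _ _, red₀_subset_abVar n⟩

lemma map_map_symm (θ : Sl n ≃ₗ⁅ℂ⁆ Sl n) (W : Submodule ℂ (Sl n)) :
    (W.map θ.toLinearEquiv.toLinearMap).map θ.symm.toLinearEquiv.toLinearMap = W := by
  rw [← Submodule.map_comp]
  have : θ.symm.toLinearEquiv.toLinearMap ∘ₗ θ.toLinearEquiv.toLinearMap = LinearMap.id :=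
    LinearMap.ext fun X => θ.symm_apply_apply X
  rw [this, Submodule.map_id]

lemma map_mem_red (θ : Sl n ≃ₗ⁅ℂ⁆ Sl n) {W : Submodule ℂ (Sl n)} (hW : W ∈ Red n) :
    W.map θ.toLinearEquiv.toLinearMap ∈ Red n := by
  refine map_mem_grClosure θ.toLinearEquiv ?_ hW
  rintro _ ⟨H, hH, rfl⟩
  exact ⟨_, isCartanSubalgebra_map θ H, rfl⟩

lemma map_mem_red_iff (θ : Sl n ≃ₗ⁅ℂ⁆ Sl n) (W : Submodule ℂ (Sl n)) :
    W.map θ.toLinearEquiv.toLinearMap ∈ Red n ↔ W ∈ Red n := by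
  refine ⟨fun h => ?_, map_mem_red θ⟩
  rw [← map_map_symm θ W]
  exact map_mem_red θ.symm h

/-- The automorphism `X ↦ -Xᵀ` of `𝔰𝔩ₙ`. -/
def negTransposeSl (n : ℕ) : Sl n ≃ₗ⁅ℂ⁆ Sl n where
  toFun X := ⟨-X.valᵀ, by
    have hX : X.val.trace = 0 := X.2
    change (-X.valᵀ).trace = 0
    rw [Matrix.trace_neg, Matrix.trace_transpose, hX, neg_zero]⟩
  invFun X := ⟨-X.valᵀ, by
    have hX : X.val.trace = 0 := X.2
    change (-X.valᵀ).trace = 0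
    rw [Matrix.trace_neg, Matrix.trace_transpose, hX, neg_zero]⟩
  map_add' X Y := Subtype.ext (by
    change -(X.val + Y.val)ᵀ = -X.valᵀ + -Y.valᵀ
    rw [Matrix.transpose_add, neg_add])
  map_smul' c X := Subtype.ext (by
    change -(c • X.val)ᵀ = c • -X.valᵀ
    rw [Matrix.transpose_smul, smul_neg])
  map_lie' {X Y} := Subtype.ext (by
    change -(X.val * Y.val - Y.val * X.val)ᵀ = -X.valᵀ * -Y.valᵀ - -Y.valᵀ * -X.valᵀ
    rw [Matrix.transpose_sub, Matrix.transpose_mul, Matrix.transpose_mul, neg_mul_neg,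
      neg_mul_neg, neg_sub])
  left_inv X := Subtype.ext (by
    change -(-X.valᵀ)ᵀ = X.val
    rw [Matrix.transpose_neg, Matrix.transpose_transpose, neg_neg])
  right_inv X := Subtype.ext (by
    change -(-X.valᵀ)ᵀ = X.val
    rw [Matrix.transpose_neg, Matrix.transpose_transpose, neg_neg])

@[simp] lemma negTransposeSl_val (X : Sl n) : (negTransposeSl n X).val = -X.valᵀ := rfl

end Varieties

/-! ### A chart centred at the minimal orbit -/

section BlockMatrices

variable {m : ℕ} {R : Type*}

/-- The square matrix of size `m + 1` with blocks `A`, `u`, `β`, `d`. -/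
def blockMat (A : Matrix (Fin m) (Fin m) R) (u β : Fin m → R) (d : R) :
    Matrix (Fin (m + 1)) (Fin (m + 1)) R :=
  Matrix.of fun p q => Fin.lastCases (motive := fun _ => R)
    (Fin.lastCases (motive := fun _ => R) d β q)
    (fun p' => Fin.lastCases (motive := fun _ => R) (u p') (A p') q) p

@[simp] lemma blockMat_castSucc_castSucc (A : Matrix (Fin m) (Fin m) R) (u β : Fin m → R) (d : R)
    (p q : Fin m) : blockMat A u β d p.castSucc q.castSucc = A p q := by simp [blockMat]

@[simp] lemma blockMat_castSucc_last (A : Matrix (Fin m) (Fin m) R) (u β : Fin m → R) (d : R)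
    (p : Fin m) : blockMat A u β d p.castSucc (Fin.last m) = u p := by simp [blockMat]

@[simp] lemma blockMat_last_castSucc (A : Matrix (Fin m) (Fin m) R) (u β : Fin m → R) (d : R)
    (q : Fin m) : blockMat A u β d (Fin.last m) q.castSucc = β q := by simp [blockMat]

@[simp] lemma blockMat_last_last (A : Matrix (Fin m) (Fin m) R) (u β : Fin m → R) (d : R) :
    blockMat A u β d (Fin.last m) (Fin.last m) = d := by simp [blockMat]

lemma ext_castSucc_last {M N : Matrix (Fin (m + 1)) (Fin (m + 1)) R}
    (h₁ : ∀ p q : Fin m, M p.castSucc q.castSucc = N p.castSucc q.castSucc)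
    (h₂ : ∀ p : Fin m, M p.castSucc (Fin.last m) = N p.castSucc (Fin.last m))
    (h₃ : ∀ q : Fin m, M (Fin.last m) q.castSucc = N (Fin.last m) q.castSucc)
    (h₄ : M (Fin.last m) (Fin.last m) = N (Fin.last m) (Fin.last m)) : M = N := by
  ext p q
  induction p using Fin.lastCases <;> induction q using Fin.lastCases <;> simp [h₁, h₂, h₃, h₄]

variable [CommRing R]

lemma blockMat_mul (A A' : Matrix (Fin m) (Fin m) R) (u β u' β' : Fin m → R) (d d' : R) :
    blockMat A u β d * blockMat A' u' β' d' =
      blockMat (A * A' + vecMulVec u β') (A *ᵥ u' + d' • u) (β ᵥ* A' + d • β')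
        (β ⬝ᵥ u' + d * d') := by
  apply ext_castSucc_last <;> intros <;>
    simp [Matrix.mul_apply, Fin.sum_univ_castSucc, mulVec, vecMul, dotProduct, vecMulVec_apply,
      mul_comm]

lemma blockMat_sub (A A' : Matrix (Fin m) (Fin m) R) (u β u' β' : Fin m → R) (d d' : R) :
    blockMat A u β d - blockMat A' u' β' d' =
      blockMat (A - A') (u - u') (β - β') (d - d') := by
  apply ext_castSucc_last <;> intros <;> simp

lemma blockMat_one : blockMat (1 : Matrix (Fin m) (Fin m) R) 0 0 1 = 1 := by
  apply ext_castSucc_last <;> intros <;> simp [Matrix.one_apply, Fin.ext_iff]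
  · intro h; omega
  · intro h; omega

lemma trace_blockMat (A : Matrix (Fin m) (Fin m) R) (u β : Fin m → R) (d : R) :
    (blockMat A u β d).trace = A.trace + d := by
  simp [Matrix.trace, Fin.sum_univ_castSucc]

/-- The vectors of the chart frame are block matrices corrected by scalars to have trace zero.
Scalars are central, so commutators ignore the correction. -/
lemma commutator_sub_smul_one {ι : Type*} [Fintype ι] [DecidableEq ι] (M N : Matrix ι ι R)
    (c d : R) : (M - c • 1) * (N - d • 1) - (N - d • 1) * (M - c • 1) = M * N - N * M := by
  simp only [sub_mul, mul_sub, Matrix.smul_mul, Matrix.mul_smul, mul_one, one_mul, smul_comm c d]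
  abel

end BlockMatrices

/-! ### The standard chart and the equations of abelian subalgebras in it. -/

section Chart

variable {m N : ℕ} (E : Fin N ≃ (Fin m × Fin m) ⊕ Fin m)

/-- The coordinates of the standard chart: the last column, the upper left block modulo scalars, and
the last row. -/
def chartEquiv : Sl (m + 1) ≃ₗ[ℂ] (Fin m ⊕ Fin N → ℂ) where
  toFun X := Sum.elim (fun i => X.val i.castSucc (Fin.last m)) fun j =>
    Sum.elim (fun pq => X.val pq.1.castSucc pq.2.castSucc -
      if pq.1 = pq.2 then X.val (Fin.last m) (Fin.last m) else 0)
      (fun p => X.val (Fin.last m) p.castSucc) (E j)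
  -- The representative modulo scalars with zero last diagonal entry is written down, then its trace
  -- is removed by a multiple of the identity.
  invFun c := ⟨blockMat (Matrix.of fun p q => c (Sum.inr (E.symm (Sum.inl (p, q)))))
      (fun i => c (Sum.inl i)) (fun p => c (Sum.inr (E.symm (Sum.inr p)))) 0 -
      ((∑ p, c (Sum.inr (E.symm (Sum.inl (p, p))))) / ((m : ℂ) + 1)) • 1, by
    have hm : (m : ℂ) + 1 ≠ 0 := by exact_mod_cast Nat.succ_ne_zero m
    refine LinearMap.mem_ker.mpr ?_
    rw [Matrix.traceLinearMap_apply, Matrix.trace_sub, trace_blockMat, Matrix.trace_smul, Matrix.trace_one, Fintype.card_fin]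
    push_cast
    rw [smul_eq_mul, div_mul_cancel₀ _ hm, Matrix.trace, add_zero]
    exact sub_self _⟩
  map_add' X Y := by
    ext (i | j)
    · rfl
    · simp only [Sum.elim_inr, Pi.add_apply]
      rcases E j with ⟨p, q⟩ | p
      · simp only [Sum.elim_inl]
        change X.val _ _ + Y.val _ _ - (if p = q then X.val _ _ + Y.val _ _ else 0) = _
        split_ifs <;> ring
      · rfl
  map_smul' c X := by
    ext (i | j)
    · rfl
    · simp only [Sum.elim_inr, Pi.smul_apply, smul_eq_mul, RingHom.id_apply]
      rcases E j with ⟨p, q⟩ | p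
      · simp only [Sum.elim_inl]
        change c * X.val _ _ - (if p = q then c * X.val _ _ else 0) = _
        split_ifs <;> ring
      · rfl
  left_inv X := by
    have hm : (m : ℂ) + 1 ≠ 0 := by exact_mod_cast Nat.succ_ne_zero m
    have htr : X.val.trace = 0 := X.2
    rw [Matrix.trace, Fin.sum_univ_castSucc] at htr
    simp only [Matrix.diag_apply] at htr
    have hs : (∑ p : Fin m, (X.val p.castSucc p.castSucc - X.val (Fin.last m) (Fin.last m))) /
        ((m : ℂ) + 1) = - X.val (Fin.last m) (Fin.last m) := by
      rw [div_eq_iff hm, Finset.sum_sub_distrib, Finset.sum_const, Finset.card_univ,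
        Fintype.card_fin, nsmul_eq_mul]
      linear_combination htr
    apply Subtype.ext
    simp only [Sum.elim_inr, Sum.elim_inl, Equiv.apply_symm_apply, if_true, hs]
    apply ext_castSucc_last
    · intro p q
      simp [Matrix.one_apply]
    · intro p
      simp [Fin.ext_iff, p.2.ne]
    · intro q
      simp [Fin.ext_iff, q.2.ne']
    · simp
  right_inv c := by
    ext (i | j)
    · simp [Matrix.one_apply, Fin.ext_iff, i.2.ne]
    · simp only [Sum.elim_inr]
      obtain ⟨j, rfl⟩ := E.symm.surjective j
      rw [E.apply_symm_apply]
      rcases j with ⟨p, q⟩ | p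
      · simp [Matrix.one_apply]
        split_ifs <;> ring
      · simp [Matrix.one_apply, Fin.ext_iff, p.2.ne']

/-- The basis of `𝔰𝔩ₘ₊₁` giving the standard chart. -/
def chartBasis : Module.Basis (Fin m ⊕ Fin N) ℂ (Sl (m + 1)) := .ofEquivFun (chartEquiv E)

/-- The coordinate of the standard chart which is the `(p, q)` entry of the upper left block of the
`i`-th vector. -/
def coordA (i p q : Fin m) : Fin m × Fin N := (i, E.symm (Sum.inl (p, q)))

/-- The coordinate of the standard chart which is the `p`-th entry of the last row of the `i`-th
vector. -/
def coordB (i p : Fin m) : Fin m × Fin N := (i, E.symm (Sum.inr p))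

lemma coordA_or_coordB (s : Fin m × Fin N) :
    (∃ i p q, s = coordA E i p q) ∨ ∃ i p, s = coordB E i p := by
  obtain ⟨i, j⟩ := s
  obtain ⟨j, rfl⟩ := E.symm.surjective j
  rcases j with ⟨p, q⟩ | p
  · exact Or.inl ⟨i, p, q, rfl⟩
  · exact Or.inr ⟨i, p, rfl⟩

/-- The upper left block of the `i`-th vector of a chart frame with coordinates `x`. -/
def blockA {R : Type*} (x : Fin m × Fin N → R) (i : Fin m) : Matrix (Fin m) (Fin m) R :=
  Matrix.of fun p q => x (coordA E i p q)

/-- The last row of the `i`-th vector of a chart frame with coordinates `x`. -/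
def rowB {R : Type*} (x : Fin m × Fin N → R) (i : Fin m) : Fin m → R :=
  fun p => x (coordB E i p)

lemma chartBasis_frame (x : Fin m × Fin N → ℂ) (i : Fin m) :
    (chartBasis E (Sum.inl i) + ∑ j, x (i, j) • chartBasis E (Sum.inr j) : Sl (m + 1)).val =
      blockMat (blockA E x i) (Pi.single i 1) (rowB E x i) 0 -
        ((blockA E x i).trace / ((m : ℂ) + 1)) • 1 := by
  let c : Fin m ⊕ Fin N → ℂ := Sum.elim (Pi.single i 1) fun j => x (i, j)
  have h : chartBasis E (Sum.inl i) + ∑ j, x (i, j) • chartBasis E (Sum.inr j) =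
      (chartEquiv E).symm c := by
    have := (chartBasis E).equivFun_symm_apply c
    rw [chartBasis, Module.Basis.equivFun_ofEquivFun] at this
    rw [this, Fintype.sum_sum_type]
    simp [c, Pi.single_apply, chartBasis]
  rw [h]
  rfl

lemma universalFrame_chartBasis (i : Fin m) :
    universalFrame (chartBasis E) i =
      blockMat (blockA E MvPolynomial.X i) (Pi.single i 1) (rowB E MvPolynomial.X i) 0 -
        (MvPolynomial.C ((m : ℂ) + 1)⁻¹ * (blockA E MvPolynomial.X i).trace) • 1 := by
  ext1 p q
  apply MvPolynomial.funext
  intro x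
  have h := congrFun (congrFun (universalFrame_map_eval (chartBasis E) x i) p) q
  rw [chartBasis_frame, Matrix.map_apply] at h
  rw [h]
  have hsc : MvPolynomial.eval x (MvPolynomial.C ((m : ℂ) + 1)⁻¹ *
      (blockA E MvPolynomial.X i).trace) = (blockA E x i).trace / ((m : ℂ) + 1) := by
    simp [Matrix.trace, blockA, div_eq_inv_mul]
  rw [Matrix.sub_apply, Matrix.sub_apply, map_sub, Matrix.smul_apply, Matrix.smul_apply, ← hsc,
    smul_eq_mul, smul_eq_mul, map_mul]
  congr 1
  · induction p using Fin.lastCases <;> induction q using Fin.lastCases <;>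
      simp [blockA, rowB, Pi.single_apply, apply_ite (MvPolynomial.eval x)]
  · simp [Matrix.one_apply, apply_ite (MvPolynomial.eval x)]

/-- Two of the four blocks carry the argument: the last column gives A(u)v = A(v)u, and the upper
left block ties [A(u), A(v)] to β. -/
lemma commutator_chartFrame (i j : Fin m) :
    universalFrame (chartBasis E) i * universalFrame (chartBasis E) j -
      universalFrame (chartBasis E) j * universalFrame (chartBasis E) i =
    blockMat (blockA E MvPolynomial.X i * blockA E MvPolynomial.X j +
          vecMulVec (Pi.single i 1) (rowB E MvPolynomial.X j) -
        (blockA E MvPolynomial.X j * blockA E MvPolynomial.X i +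
          vecMulVec (Pi.single j 1) (rowB E MvPolynomial.X i)))
      (blockA E MvPolynomial.X i *ᵥ Pi.single j 1 - blockA E MvPolynomial.X j *ᵥ Pi.single i 1)
      (rowB E MvPolynomial.X i ᵥ* blockA E MvPolynomial.X j -
        rowB E MvPolynomial.X j ᵥ* blockA E MvPolynomial.X i)
      (rowB E MvPolynomial.X i ⬝ᵥ Pi.single j 1 - rowB E MvPolynomial.X j ⬝ᵥ Pi.single i 1) := by
  rw [universalFrame_chartBasis, universalFrame_chartBasis, commutator_sub_smul_one, blockMat_mul,
    blockMat_mul, blockMat_sub]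
  simp

/-- The equations of abelian subalgebras force the blocks of a chart frame to be symmetric. -/
lemma coordA_symm_mem (i j p : Fin m) :
    (MvPolynomial.X (coordA E i p j) - MvPolynomial.X (coordA E j p i) :
      MvPolynomial (Fin m × Fin N) ℂ) ∈ abSchemeIdeal (chartBasis E) := by
  refine Ideal.subset_span ⟨i, j, p.castSucc, Fin.last m, ?_⟩
  rw [commutator_chartFrame, blockMat_castSucc_last]
  simp [blockA]

/-- For p = i ≠ j this expresses a coordinate of β through quadratic terms in A. For p distinct from
both i and j no β occurs and a quadric in A remains. -/
lemma commutator_block_mem (i j p q : Fin m) :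
    (∑ l, MvPolynomial.X (coordA E i p l) * MvPolynomial.X (coordA E j l q) -
      ∑ l, MvPolynomial.X (coordA E j p l) * MvPolynomial.X (coordA E i l q) +
      ((if p = i then MvPolynomial.X (coordB E j q) else 0) -
        if p = j then MvPolynomial.X (coordB E i q) else 0) :
      MvPolynomial (Fin m × Fin N) ℂ) ∈ abSchemeIdeal (chartBasis E) := by
  refine Ideal.subset_span ⟨i, j, p.castSucc, q.castSucc, ?_⟩
  rw [commutator_chartFrame, blockMat_castSucc_castSucc]
  simp only [Matrix.sub_apply, Matrix.add_apply, Matrix.mul_apply, vecMulVec_apply, blockA, rowB,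
    Matrix.of_apply, Pi.single_apply, ite_mul, one_mul, zero_mul]
  ring

/-- The index set of the coordinates on the space of symmetric bilinear maps from `U` to `U`. -/
abbrev SymIndex (m : ℕ) : Type := {p : Fin m × Fin m // p.1 ≤ p.2} × Fin m

/-- The coordinates of the chart which restrict to coordinates of the tangent space. -/
def symCoord (t : SymIndex m) : Fin m × Fin N := coordA E t.1.1.1 t.2 t.1.1.2

lemma card_symIndex (m : ℕ) : Fintype.card (SymIndex m) = (m + 1) * m ^ 2 / 2 := by
  rw [Fintype.card_prod, ← Fintype.card_congr (Sym2.sortEquiv (α := Fin m)), Sym2.card,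
    Fintype.card_fin]
  have h := Nat.triangle_succ m
  have h2 : 2 * (m + 1).choose 2 = (m + 1) * m := by
    rw [Nat.choose_two_right, Nat.mul_div_cancel' (Nat.even_mul_pred_self (m + 1)).two_dvd]
    rfl
  have h3 : (m + 1) * m ^ 2 = 2 * ((m + 1).choose 2 * m) := by
    rw [← mul_assoc, h2]; ring
  rw [h3, Nat.mul_div_cancel_left _ (by norm_num)]

/-- The coordinates of the tangent space generate all coordinates modulo the equations of abelian
subalgebras. -/
lemma X_mem_abSchemeIdeal_sup (hm : 2 ≤ m) (s : Fin m × Fin N) :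
    MvPolynomial.X s ∈ abSchemeIdeal (chartBasis E) ⊔
      Ideal.span (Set.range fun t => (MvPolynomial.X (symCoord E t) :
        MvPolynomial (Fin m × Fin N) ℂ)) := by
  set K := abSchemeIdeal (chartBasis E) ⊔
      Ideal.span (Set.range fun t => (MvPolynomial.X (symCoord E t) :
        MvPolynomial (Fin m × Fin N) ℂ))
  have hK : abSchemeIdeal (chartBasis E) ≤ K := le_sup_left
  have h1 {i j : Fin m} (hij : i ≤ j) (p : Fin m) : MvPolynomial.X (coordA E i p j) ∈ K :=
    Ideal.mem_sup_right (Ideal.subset_span ⟨(⟨(i, j), hij⟩, p), rfl⟩)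
  have hA (i p j : Fin m) : MvPolynomial.X (coordA E i p j) ∈ K := by
    rcases le_total i j with hij | hij
    · exact h1 hij p
    · have := add_mem (hK (coordA_symm_mem E i j p)) (h1 hij p)
      rwa [sub_add_cancel] at this
  rcases coordA_or_coordB E s with ⟨i, p, q, rfl⟩ | ⟨j, q, rfl⟩
  · exact hA i p q
  · have : Nontrivial (Fin m) := Fin.nontrivial_iff_two_le.mpr hm
    -- A second index exists because m ≥ 2. Row i of the commutator then contains β_j and otherwise
    -- only products of coordinates of A.
    obtain ⟨i, hij⟩ := exists_ne j
    have h := hK (commutator_block_mem E i j i q)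
    rw [if_pos rfl, if_neg hij, sub_zero] at h
    refine (Ideal.add_mem_iff_right K ?_).mp h
    exact sub_mem (Ideal.sum_mem _ fun l _ => Ideal.mul_mem_right _ _ (hA _ _ _))
      (Ideal.sum_mem _ fun l _ => Ideal.mul_mem_right _ _ (hA _ _ _))

/-- Modulo the other coordinates of the tangent space, the product of two of its coordinates
vanishes on abelian subalgebras. -/
lemma X_mul_X_mem_abSchemeIdeal_sup {i j k : Fin m} (hij : i < j) (hik : i ≠ k) (hjk : j ≠ k) :
    MvPolynomial.X (symCoord E (⟨(i, i), le_rfl⟩, i)) *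
      MvPolynomial.X (symCoord E (⟨(i, j), hij.le⟩, k)) ∈
    abSchemeIdeal (chartBasis E) ⊔
      Ideal.span ((fun t => (MvPolynomial.X (symCoord E t) : MvPolynomial (Fin m × Fin N) ℂ)) ''
        {(⟨(i, i), le_rfl⟩, i), (⟨(i, j), hij.le⟩, k)}ᶜ) := by
  set K := abSchemeIdeal (chartBasis E) ⊔
      Ideal.span ((fun t => (MvPolynomial.X (symCoord E t) : MvPolynomial (Fin m × Fin N) ℂ)) ''
        {(⟨(i, i), le_rfl⟩, i), (⟨(i, j), hij.le⟩, k)}ᶜ)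
  have hK : abSchemeIdeal (chartBasis E) ≤ K := le_sup_left
  let π := Ideal.Quotient.mk K
  let a (i p j : Fin m) := π (MvPolynomial.X (coordA E i p j))
  have hsymm (i p j : Fin m) : a i p j = a j p i := by
    rw [← sub_eq_zero, ← map_sub]
    exact Ideal.Quotient.eq_zero_iff_mem.mpr (hK (coordA_symm_mem E i j p))
  have hle {i' j' : Fin m} (h' : i' ≤ j') (p : Fin m) (h1 : ¬ (i' = i ∧ p = i ∧ j' = i))
      (h2 : ¬ (i' = i ∧ p = k ∧ j' = j)) : a i' p j' = 0 := by
    refine Ideal.Quotient.eq_zero_iff_mem.mpr (Ideal.mem_sup_right (Ideal.subset_span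
      ⟨(⟨(i', j'), h'⟩, p), ?_, rfl⟩))
    simp only [Set.mem_compl_iff, Set.mem_insert_iff, Set.mem_singleton_iff, Prod.mk.injEq,
      Subtype.mk.injEq]
    tauto
  have hzero (i' p j' : Fin m) (h1 : ¬ (i' = i ∧ p = i ∧ j' = i))
      (h2 : ¬ (i' = i ∧ p = k ∧ j' = j)) (h3 : ¬ (j' = i ∧ p = k ∧ i' = j)) : a i' p j' = 0 := by
    rcases le_total i' j' with h | h
    · exact hle h p h1 h2
    · rw [hsymm]
      exact hle h p (by tauto) h3
  -- Row k avoids i and j, so β drops out. Modulo `K` only `a i i i` and `a i k j = a j k i` may be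
  -- nonzero, and the single product left is the term l = i of the second sum.
  have hc := Ideal.Quotient.eq_zero_iff_mem.mpr (hK (commutator_block_mem E i j k i))
  rw [if_neg hik.symm, if_neg hjk.symm, sub_zero, add_zero] at hc
  simp only [map_sub, map_sum, map_mul] at hc
  change ∑ l, a i k l * a j l i - ∑ l, a j k l * a i l i = 0 at hc
  rw [Finset.sum_eq_zero (fun l _ => ?_), zero_sub, neg_eq_zero,
    Finset.sum_eq_single i (fun l _ hl => ?_) (by simp), hsymm j k i] at hc
  · rw [← Ideal.Quotient.eq_zero_iff_mem, map_mul, mul_comm]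
    exact hc
  · rw [hzero i l i (by tauto) (by grind) (by grind), mul_zero]
  · by_cases hl : l = k
    · rw [hzero i k l (by grind) (by grind) (by grind), zero_mul]
    · rw [hzero j l i (by grind) (by grind) (by grind), mul_zero]

end Chart

/-! ### Tangent vectors of the variety of reductions -/

section Reductions

variable {m N : ℕ} (E : Fin N ≃ (Fin m × Fin m) ⊕ Fin m)

/-- The point of the chart given by the semisimple algebra structure on `U` for which the columns
of `P` are multiples of orthogonal idempotents, with factors the entries of `c`. -/
def algebraPoint (P : GL (Fin m) ℂ) (c : Fin m → ℂ) : Fin m × Fin N → ℂ := fun s =>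
  Sum.elim (fun pq => ∑ l, c l * P⁻¹.val l s.1 * P⁻¹.val l pq.2 * P.val pq.1 l) (fun _ => 0) (E s.2)

lemma blockA_algebraPoint (P : GL (Fin m) ℂ) (c : Fin m → ℂ) (i : Fin m) :
    blockA E (algebraPoint E P c) i =
      P.val * diagonal (fun l => c l * P⁻¹.val l i) * P⁻¹.val := by
  ext p q
  rw [Matrix.mul_apply]
  simp only [blockA, coordA, algebraPoint, Matrix.of_apply, Equiv.apply_symm_apply, Sum.elim_inl,
    mul_diagonal]
  exact Finset.sum_congr rfl fun l _ => by ring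

lemma rowB_algebraPoint (P : GL (Fin m) ℂ) (c : Fin m → ℂ) (i : Fin m) :
    rowB E (algebraPoint E P c) i = 0 := by
  ext p
  simp [rowB, coordB, algebraPoint]

lemma algebraPoint_add (P : GL (Fin m) ℂ) (c d : Fin m → ℂ) :
    algebraPoint E P (c + d) = algebraPoint E P c + algebraPoint E P d := by
  ext s
  simp only [algebraPoint, Pi.add_apply]
  rcases E s.2 with pq | p
  · simp only [Sum.elim_inl, ← Finset.sum_add_distrib]
    exact Finset.sum_congr rfl fun l _ => by ring
  · simp

lemma algebraPoint_smul (P : GL (Fin m) ℂ) (t : ℂ) (c : Fin m → ℂ) :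
    algebraPoint E P (t • c) = t • algebraPoint E P c := by
  ext s
  simp only [algebraPoint, Pi.smul_apply, smul_eq_mul]
  rcases E s.2 with pq | p
  · simp only [Sum.elim_inl, Finset.mul_sum]
    exact Finset.sum_congr rfl fun l _ => by ring
  · simp

/-- The invertible matrix with diagonalizing columns for the semisimple algebra structure of
`algebraPoint`. -/
def diagonalizer (P : GL (Fin m) ℂ) (c : Fin m → ℂ) : GL (Fin (m + 1)) ℂ where
  -- When no `c l` is zero, `P *ᵥ c⁻¹` is the unit of the algebra: every A(u) sends it to u. The
  -- last column therefore spans the common kernel of the matrices (A(u), u; 0, 0).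
  val := blockMat P.val (-(P.val *ᵥ c⁻¹)) 0 1
  inv := blockMat P⁻¹.val c⁻¹ 0 1
  val_inv := by
    rw [blockMat_mul, ← blockMat_one]
    congr 1 <;> simp
  inv_val := by
    rw [blockMat_mul, ← blockMat_one]
    congr 1 <;> simp [mulVec_neg]

/-- Conjugating by `diagonalizer` makes the frame diagonal, and equality of dimensions identifies
its span with a conjugate of the diagonal subalgebra. -/
lemma grChart_algebraPoint_mem_red₀ (P : GL (Fin m) ℂ) (c : Fin m → ℂ) (hc : ∀ l, c l ≠ 0) :
    grChart (chartBasis E) (algebraPoint E P c) ∈ Red₀ (m + 1) := by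
  refine ⟨_, isCartanSubalgebra_map (conjSl (diagonalizer P c)) (diagSl (m + 1)), ?_⟩
  symm
  apply Submodule.eq_of_le_of_finrank_eq
  · rw [grChart, Submodule.span_le]
    rintro _ ⟨i, rfl⟩
    set X := chartBasis E (Sum.inl i) +
      ∑ j, algebraPoint E P c (i, j) • chartBasis E (Sum.inr j) with hXdef
    refine ⟨(conjSl (diagonalizer P c)).symm X, ?_, (conjSl (diagonalizer P c)).apply_symm_apply X⟩
    change Matrix.IsDiag _
    have hXv := chartBasis_frame E (algebraPoint E P c) i
    rw [← hXdef, rowB_algebraPoint, blockA_algebraPoint] at hXv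
    rw [conjSl_symm, conjSl_val, hXv, inv_inv, mul_sub, sub_mul]
    have h1 : (diagonalizer P c).val = blockMat P.val (-(P.val *ᵥ c⁻¹)) 0 1 := rfl
    have h2 : (diagonalizer P c)⁻¹.val = blockMat P⁻¹.val c⁻¹ 0 1 := rfl
    have h3 : (diagonalizer P c)⁻¹.val *
        blockMat (P.val * diagonal (fun l => c l * P⁻¹.val l i) * P⁻¹.val) (Pi.single i 1) 0 0 *
        (diagonalizer P c).val = blockMat (diagonal (fun l => c l * P⁻¹.val l i)) 0 0 0 := by
      have hinv : P⁻¹.val * P.val = 1 := Units.inv_mul P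
      rw [h1, h2, blockMat_mul, blockMat_mul]
      congr 1
      · simp only [vecMulVec_zero, add_zero, mul_assoc, hinv, mul_one]
        rw [← mul_assoc, hinv, one_mul]
      · simp only [vecMulVec_zero, add_zero, zero_smul, one_smul, mulVec_neg, mulVec_mulVec,
          mul_assoc, hinv, mul_one]
        rw [← mul_assoc, hinv, one_mul]
        ext l
        simp [mulVec_diagonal]
        field_simp [hc l]
        simp
      · simp
      · simp
    rw [h3, Matrix.mul_smul, mul_one, Matrix.smul_mul, Units.inv_mul]
    refine Matrix.IsDiag.sub ?_ (Matrix.isDiag_one.smul _)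
    intro p q hpq
    induction p using Fin.lastCases <;> induction q using Fin.lastCases <;> simp_all
  · rw [finrank_grChart]
    have := (conjSl (diagonalizer P c)).toLinearEquiv.finrank_map_eq (diagSl (m + 1)).toSubmodule
    have h2 := finrank_diagSl (m + 1)
    exact (this.trans h2).symm

/-- Adding s to all the factors makes them nonzero for all but finitely many s, so degenerate
structures are limits of Cartan subalgebras along a line of the chart. -/
lemma grChart_algebraPoint_mem_red (P : GL (Fin m) ℂ) (c : Fin m → ℂ)
    (F : Fin ((m + 1) * m) ≃ (Fin m × Fin m) ⊕ Fin m) :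
    grChart (chartBasis F) (algebraPoint F P c) ∈ Red (m + 1) := by
  refine grChart_mem_grClosure (chartBasis F) _ (algebraPoint F P 1) ?_
  have hfin : (Set.range fun l => -c l).Finite := Set.finite_range _
  refine hfin.infinite_compl.mono fun s hs => ?_
  rw [Set.mem_ofPred_eq, ← algebraPoint_smul, ← algebraPoint_add]
  refine grChart_algebraPoint_mem_red₀ F P _ fun l hl => hs ⟨l, ?_⟩
  simp at hl
  linear_combination -hl

/-- The tangent direction given by the algebra structure `(u, v) ↦ λ(u) λ(v) w`. -/
def rankOneDirection (lam w : Fin m → ℂ) : Fin m × Fin N → ℂ := fun s =>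
  Sum.elim (fun pq => lam s.1 * lam pq.2 * w pq.1) (fun _ => 0) (E s.2)

/-- Completing w by vectors of ker λ gives a basis whose dual basis contains λ. This makes λ² ⊗ w an
`algebraPoint` with one nonzero factor. -/
lemma exists_GL_of_dotProduct_eq_one {lam w : Fin m → ℂ} (h : lam ⬝ᵥ w = 1) :
    ∃ (P : GL (Fin m) ℂ) (i : Fin m), (∀ p, P.val p i = w p) ∧ ∀ q, P⁻¹.val i q = lam q := by
  obtain ⟨i, hi⟩ : ∃ i, lam i ≠ 0 := by
    by_contra! hcon
    simp [dotProduct, hcon] at h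
  -- `e` sends eᵢ to w and, for j ≠ i, eⱼ to eⱼ - (λⱼ/λᵢ) eᵢ, which lies in ker λ.
  let e : (Fin m → ℂ) ≃ₗ[ℂ] (Fin m → ℂ) :=
    { toFun x := x + x i • (w - Pi.single i 1) - ((lam ⬝ᵥ x - lam i * x i) / lam i) • Pi.single i 1
      invFun v := v - (lam ⬝ᵥ v) • w + (lam ⬝ᵥ v + lam ⬝ᵥ v * w i - v i) • Pi.single i 1
      map_add' x y := by
        ext j
        simp [dotProduct_add]
        ring
      map_smul' c x := by
        ext j
        simp [dotProduct_smul]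
        ring
      left_inv x := by
        have h1 : lam ⬝ᵥ (x + x i • (w - Pi.single i 1) -
            ((lam ⬝ᵥ x - lam i * x i) / lam i) • Pi.single i 1) = x i := by
          simp only [dotProduct_sub, dotProduct_add, dotProduct_smul, h, dotProduct_single_one,
            smul_eq_mul]
          field_simp
          ring
        ext j
        simp only [h1]
        by_cases hj : j = i
        · subst hj
          simp
        · simp [hj]
      right_inv v := by
        have h1 : (v - (lam ⬝ᵥ v) • w +
            (lam ⬝ᵥ v + lam ⬝ᵥ v * w i - v i) • (Pi.single i 1 : Fin m → ℂ)) i = lam ⬝ᵥ v := by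
          simp
        have h2 : lam ⬝ᵥ (v - (lam ⬝ᵥ v) • w +
            (lam ⬝ᵥ v + lam ⬝ᵥ v * w i - v i) • Pi.single i 1) =
            (lam ⬝ᵥ v + lam ⬝ᵥ v * w i - v i) * lam i := by
          simp only [dotProduct_sub, dotProduct_add, dotProduct_smul, h, dotProduct_single_one,
            smul_eq_mul]
          ring
        simp only [h1, h2]
        ext j
        by_cases hj : j = i
        · subst hj
          simp
          field_simp
          ring
        · simp [hj] }
  obtain ⟨P, hP, hP'⟩ := exists_GL_mulVec e
  refine ⟨P, i, fun p => ?_, fun q => ?_⟩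
  · have := congrFun (hP (Pi.single i 1)) p
    simp [e] at this
    exact this
  · have := congrFun (hP' (Pi.single q 1)) i
    simp [e, -Matrix.coe_units_inv] at this
    exact this

variable (F : Fin ((m + 1) * m) ≃ (Fin m × Fin m) ⊕ Fin m)

/-- The multiples of λ² ⊗ w come from scaling the single factor, so a whole line through the origin
lies in the trace of `Red` on the chart. -/
lemma rankOneDirection_mem_of_dotProduct_eq_one {lam w : Fin m → ℂ} (h : lam ⬝ᵥ w = 1) :
    rankOneDirection F lam w ∈ tangentAtOrigin (chartIdeal (chartBasis F) (Red (m + 1))) := by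
  obtain ⟨P, i, hP, hP'⟩ := exists_GL_of_dotProduct_eq_one h
  have h1 : rankOneDirection F lam w = algebraPoint F P (Pi.single i 1) := by
    ext s
    simp only [rankOneDirection, algebraPoint]
    rcases F s.2 with pq | p
    · simp [Pi.single_apply, hP, hP', -Matrix.coe_units_inv]
    · simp
  refine mem_tangentAtOrigin_of_line fun t => ?_
  rw [h1, ← algebraPoint_smul]
  exact grChart_algebraPoint_mem_red P _ F

/-- The direction is linear in w, and every w is a combination of vectors on which λ takes the value
1. -/
lemma rankOneDirection_mem {lam : Fin m → ℂ} (hlam : lam ≠ 0) (w : Fin m → ℂ) :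
    rankOneDirection F lam w ∈ tangentAtOrigin (chartIdeal (chartBasis F) (Red (m + 1))) := by
  obtain ⟨i, hi⟩ : ∃ i, lam i ≠ 0 := by
    by_contra! hcon
    exact hlam (funext hcon)
  let w₀ : Fin m → ℂ := Pi.single i (lam i)⁻¹
  have hw₀ : lam ⬝ᵥ w₀ = 1 := by simp [w₀, hi]
  have h1 : lam ⬝ᵥ (w + (1 - lam ⬝ᵥ w) • w₀) = 1 := by
    rw [dotProduct_add, dotProduct_smul, hw₀]
    simp
  have h2 : rankOneDirection F lam w = rankOneDirection F lam (w + (1 - lam ⬝ᵥ w) • w₀) -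
      (1 - lam ⬝ᵥ w) • rankOneDirection F lam w₀ := by
    ext s
    simp only [rankOneDirection, Pi.sub_apply, Pi.smul_apply]
    rcases F s.2 with pq | p
    · simp
      ring
    · simp
  rw [h2]
  exact sub_mem (rankOneDirection_mem_of_dotProduct_eq_one F h1)
    (Submodule.smul_mem _ _ (rankOneDirection_mem_of_dotProduct_eq_one F hw₀))

/-- The tangent direction dual to one of the coordinates on the tangent space. -/
def symDirection (t : SymIndex m) : Fin m × Fin N → ℂ := fun s =>
  Sum.elim (fun pq => if pq.1 = t.2 ∧ ((s.1 = t.1.1.1 ∧ pq.2 = t.1.1.2) ∨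
    (s.1 = t.1.1.2 ∧ pq.2 = t.1.1.1)) then 1 else 0) (fun _ => 0) (E s.2)

lemma symDirection_symCoord (t t' : SymIndex m) :
    symDirection E t (symCoord E t') = if t = t' then 1 else 0 := by
  obtain ⟨⟨⟨i, j⟩, hij⟩, k⟩ := t
  obtain ⟨⟨⟨i', j'⟩, hij'⟩, k'⟩ := t'
  simp only [symDirection, symCoord, coordA, Equiv.apply_symm_apply, Sum.elim_inl, Prod.mk.injEq,
    Subtype.mk.injEq]
  simp only at hij hij'
  congr 1
  rw [eq_iff_iff]
  constructor
  · rintro ⟨rfl, ⟨rfl, rfl⟩ | ⟨rfl, rfl⟩⟩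
    · simp
    · exact ⟨⟨le_antisymm hij hij', le_antisymm hij' hij⟩, rfl⟩
  · rintro ⟨⟨rfl, rfl⟩, rfl⟩
    simp

/-- Polarization: for i ≠ j the symmetric product of two coordinate forms is (εᵢ + εⱼ)² - εᵢ² - εⱼ².
-/
lemma symDirection_mem (t : SymIndex m) :
    symDirection F t ∈ tangentAtOrigin (chartIdeal (chartBasis F) (Red (m + 1))) := by
  obtain ⟨⟨⟨i, j⟩, hij⟩, k⟩ := t
  have hne (i : Fin m) : (Pi.single i 1 : Fin m → ℂ) ≠ 0 := by simp
  by_cases h : i = j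
  · subst h
    have h1 : symDirection F (⟨(i, i), hij⟩, k) =
        rankOneDirection F (Pi.single i 1) (Pi.single k 1) := by
      ext s
      simp only [symDirection, rankOneDirection]
      rcases F s.2 with ⟨p, q⟩ | p
      · simp only [Sum.elim_inl, Pi.single_apply, or_self, ite_and]
        split_ifs <;> simp
      · simp
    rw [h1]
    exact rankOneDirection_mem F (hne i) _
  · have h1 : symDirection F (⟨(i, j), hij⟩, k) =
        rankOneDirection F (Pi.single i 1 + Pi.single j 1) (Pi.single k 1) -
        rankOneDirection F (Pi.single i 1) (Pi.single k 1) -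
        rankOneDirection F (Pi.single j 1) (Pi.single k 1) := by
      ext s
      simp only [symDirection, rankOneDirection, Pi.sub_apply, Pi.add_apply]
      rcases F s.2 with ⟨p, q⟩ | p
      · simp only [Sum.elim_inl, Pi.single_apply]
        by_cases hp : p = k <;> by_cases h1 : s.1 = i <;> by_cases h2 : s.1 = j <;>
          by_cases h3 : q = i <;> by_cases h4 : q = j <;> simp_all
      · simp
    rw [h1]
    refine sub_mem (sub_mem (rankOneDirection_mem F ?_ _) (rankOneDirection_mem F (hne i) _))
      (rankOneDirection_mem F (hne j) _)
    intro h0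
    have := congrFun h0 i
    simp [h] at this

end Reductions

/-! ### The minimal orbits -/

section Orbits

variable {n m N : ℕ}

lemma mem_nilSubalgebra {L : Submodule ℂ (Fin n → ℂ)} {X : Sl n} :
    X ∈ nilSubalgebra L ↔ (∀ v, X.val *ᵥ v ∈ L) ∧ ∀ v ∈ L, X.val *ᵥ v = 0 := Iff.rfl

/-- The hyperplane spanned by all but the last vector of the standard basis. -/
def stdHyperplane (m : ℕ) : Submodule ℂ (Fin (m + 1) → ℂ) :=
  LinearMap.ker (LinearMap.proj (Fin.last m))

lemma mem_stdHyperplane {v : Fin (m + 1) → ℂ} : v ∈ stdHyperplane m ↔ v (Fin.last m) = 0 := Iff.rfl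

/-- The line spanned by the last vector of the standard basis. -/
def stdLine (m : ℕ) : Submodule ℂ (Fin (m + 1) → ℂ) := ℂ ∙ Pi.single (Fin.last m) 1

lemma finrank_stdHyperplane (m : ℕ) : Module.finrank ℂ (stdHyperplane m) = m := by
  have hne : (LinearMap.proj (Fin.last m) : Module.Dual ℂ (Fin (m + 1) → ℂ)) ≠ 0 := fun h => by
    have := DFunLike.congr_fun h (Pi.single (Fin.last m) 1)
    simp at this
  have := Module.Dual.finrank_ker_add_one_of_ne_zero hne
  rw [Module.finrank_fin_fun] at this
  rw [stdHyperplane]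
  omega

lemma finrank_stdLine (m : ℕ) : Module.finrank ℂ (stdLine m) = 1 :=
  finrank_span_singleton (by simp)

lemma mem_stdLine {v : Fin (m + 1) → ℂ} : v ∈ stdLine m ↔ ∀ i : Fin m, v i.castSucc = 0 := by
  rw [stdLine, Submodule.mem_span_singleton]
  constructor
  · rintro ⟨c, rfl⟩ i
    simp
  · intro h
    refine ⟨v (Fin.last m), ?_⟩
    ext i
    induction i using Fin.lastCases <;> simp [h]

lemma exists_GL_map_eq {L L' : Submodule ℂ (Fin n → ℂ)}
    (h : Module.finrank ℂ L = Module.finrank ℂ L') :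
    ∃ g : GL (Fin n) ℂ, ∀ v, v ∈ L ↔ g.val *ᵥ v ∈ L' := by
  let f := LinearEquiv.ofFinrankEq L L' h
  obtain ⟨e, he⟩ := Submodule.exists_linearEquiv_restrict_eq f
  obtain ⟨g, hg, -⟩ := exists_GL_mulVec e
  have hmem {v : Fin n → ℂ} (hv : v ∈ L) : e v ∈ L' := by
    rw [← he ⟨v, hv⟩]
    exact (f ⟨v, hv⟩).2
  refine ⟨g, fun v => ?_⟩
  rw [hg]
  refine ⟨hmem, fun hv => ?_⟩
  obtain ⟨w, hw⟩ := f.surjective ⟨e v, hv⟩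
  have h1 : e w = e v := by rw [← he, hw]
  rw [← e.injective h1]
  exact w.2

lemma nilSubalgebra_eq_map_conjSl {L L' : Submodule ℂ (Fin n → ℂ)} {g : GL (Fin n) ℂ}
    (h : ∀ v, v ∈ L ↔ g.val *ᵥ v ∈ L') :
    nilSubalgebra L' = (nilSubalgebra L).map (conjSl g).toLinearEquiv.toLinearMap := by
  have hinv (v : Fin n → ℂ) : g.val *ᵥ g⁻¹.val *ᵥ v = v := by
    rw [mulVec_mulVec, Units.mul_inv, one_mulVec]
  have hinv' (v : Fin n → ℂ) : g⁻¹.val *ᵥ g.val *ᵥ v = v := by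
    rw [mulVec_mulVec, Units.inv_mul, one_mulVec]
  have key (X : Sl n) : X ∈ nilSubalgebra L ↔ conjSl g X ∈ nilSubalgebra L' := by
    rw [mem_nilSubalgebra, mem_nilSubalgebra]
    simp only [conjSl_val, ← mulVec_mulVec]
    refine and_congr ⟨fun h1 v => (h _).mp (h1 _), fun h1 v => ?_⟩
      ⟨fun h1 v hv => ?_, fun h1 v hv => ?_⟩
    · have := h1 (g.val *ᵥ v)
      rwa [hinv', ← h] at this
    · rw [h1, mulVec_zero]
      rwa [h, hinv]
    · have := h1 _ ((h v).mp hv)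
      rw [hinv'] at this
      rw [← hinv' (X.val *ᵥ v), this, mulVec_zero]
  ext X
  constructor
  · intro hX
    refine ⟨(conjSl g).symm X, ?_, (conjSl g).apply_symm_apply X⟩
    rw [SetLike.mem_coe, key, (conjSl g).apply_symm_apply]
    exact hX
  · rintro ⟨Y, hY, rfl⟩
    exact (key Y).mp hY

lemma mem_nilSubalgebra_stdHyperplane {X : Sl (m + 1)} : X ∈ nilSubalgebra (stdHyperplane m) ↔
    (∀ q, X.val (Fin.last m) q = 0) ∧ ∀ p (q : Fin m), X.val p q.castSucc = 0 := by
  rw [mem_nilSubalgebra]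
  refine and_congr ⟨fun h q => ?_, fun h v => ?_⟩ ⟨fun h p q => ?_, fun h v hv => ?_⟩
  · have := h (Pi.single q 1)
    rw [mem_stdHyperplane] at this
    simpa using this
  · rw [mem_stdHyperplane]
    simp [mulVec, dotProduct, h]
  · have := congrFun (h (Pi.single q.castSucc 1) (by simp [mem_stdHyperplane])) p
    simpa using this
  · ext p
    rw [mem_stdHyperplane] at hv
    simp [mulVec, dotProduct, Fin.sum_univ_castSucc, h, hv]

lemma mem_nilSubalgebra_stdLine {X : Sl (m + 1)} : X ∈ nilSubalgebra (stdLine m) ↔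
    (∀ q, X.val q (Fin.last m) = 0) ∧ ∀ p (q : Fin m), X.val q.castSucc p = 0 := by
  rw [mem_nilSubalgebra, and_comm]
  refine and_congr ⟨fun h q => ?_, fun h v hv => ?_⟩ ⟨fun h p q => ?_, fun h v => ?_⟩
  · have := congrFun (h (Pi.single (Fin.last m) 1) (by simp [mem_stdLine])) q
    simpa using this
  · ext p
    rw [mem_stdLine] at hv
    simp [mulVec, dotProduct, Fin.sum_univ_castSucc, h, hv]
  · have := h (Pi.single p 1)
    rw [mem_stdLine] at this
    simpa using this q
  · rw [mem_stdLine]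
    simp [mulVec, dotProduct, h]

/-- Transposition exchanges image and kernel conditions, hence lines and hyperplanes, which reduces
both orbits to one base point. -/
lemma nilSubalgebra_stdLine_eq_map : nilSubalgebra (stdLine m) =
    (nilSubalgebra (stdHyperplane m)).map (negTransposeSl (m + 1)).toLinearEquiv.toLinearMap := by
  have key (X : Sl (m + 1)) : X ∈ nilSubalgebra (stdHyperplane m) ↔
      negTransposeSl (m + 1) X ∈ nilSubalgebra (stdLine m) := by
    rw [mem_nilSubalgebra_stdHyperplane, mem_nilSubalgebra_stdLine]
    simp
  ext X
  constructor
  · intro hX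
    refine ⟨(negTransposeSl (m + 1)).symm X, ?_, (negTransposeSl (m + 1)).apply_symm_apply X⟩
    rw [SetLike.mem_coe, key, (negTransposeSl (m + 1)).apply_symm_apply]
    exact hX
  · rintro ⟨Y, hY, rfl⟩
    exact (key Y).mp hY

lemma exists_eq_map_of_mem_oMin'' {W : Submodule ℂ (Sl (m + 1))} (hW : W ∈ OMin'' (m + 1)) :
    ∃ θ : Sl (m + 1) ≃ₗ⁅ℂ⁆ Sl (m + 1),
      W = (nilSubalgebra (stdHyperplane m)).map θ.toLinearEquiv.toLinearMap := by
  obtain ⟨L, hL, rfl⟩ := hW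
  obtain ⟨g, hg⟩ := exists_GL_map_eq ((finrank_stdHyperplane m).trans hL.symm)
  exact ⟨conjSl g, nilSubalgebra_eq_map_conjSl hg⟩

lemma exists_eq_map_of_mem_oMin' {W : Submodule ℂ (Sl (m + 1))} (hW : W ∈ OMin' (m + 1)) :
    ∃ θ : Sl (m + 1) ≃ₗ⁅ℂ⁆ Sl (m + 1),
      W = (nilSubalgebra (stdHyperplane m)).map θ.toLinearEquiv.toLinearMap := by
  obtain ⟨L, hL, rfl⟩ := hW
  obtain ⟨g, hg⟩ := exists_GL_map_eq ((finrank_stdLine m).trans hL.symm)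
  refine ⟨(negTransposeSl (m + 1)).trans (conjSl g), ?_⟩
  rw [nilSubalgebra_eq_map_conjSl hg, nilSubalgebra_stdLine_eq_map, ← Submodule.map_comp]
  rfl

lemma grChart_chartBasis_zero (E : Fin N ≃ (Fin m × Fin m) ⊕ Fin m) :
    grChart (chartBasis E) 0 = nilSubalgebra (stdHyperplane m) := by
  have hb (i : Fin m) : (chartBasis E (Sum.inl i)).val = blockMat 0 (Pi.single i 1) 0 0 := by
    have h := chartBasis_frame E 0 i
    have h1 : blockA E (0 : Fin m × Fin N → ℂ) i = 0 := rfl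
    have h2 : rowB E (0 : Fin m × Fin N → ℂ) i = 0 := rfl
    simpa [h1, h2] using h
  rw [grChart]
  simp only [Pi.zero_apply, zero_smul, Finset.sum_const_zero, add_zero]
  apply le_antisymm
  · rw [Submodule.span_le]
    rintro _ ⟨i, rfl⟩
    rw [SetLike.mem_coe, mem_nilSubalgebra_stdHyperplane, hb]
    constructor
    · intro q
      induction q using Fin.lastCases <;> simp
    · intro p q
      induction p using Fin.lastCases <;> simp
  · intro X hX
    rw [mem_nilSubalgebra_stdHyperplane] at hX
    have : X = ∑ i : Fin m, X.val i.castSucc (Fin.last m) • chartBasis E (Sum.inl i) := by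
      apply Subtype.ext
      have h1 : (∑ i : Fin m, X.val i.castSucc (Fin.last m) • chartBasis E (Sum.inl i)).val =
          ∑ i : Fin m, X.val i.castSucc (Fin.last m) • blockMat 0 (Pi.single i 1) 0 0 := by
        simp [hb]
      rw [h1]
      apply ext_castSucc_last <;> intros <;> simp [Matrix.sum_apply, hX.1, hX.2, Pi.single_apply]
    rw [this]
    exact Submodule.sum_mem _ fun i _ => Submodule.smul_mem _ _ (Submodule.subset_span ⟨i, rfl⟩)

/-- The base point is the zero algebra structure, the degenerate case where all the factors vanish.
-/
lemma nilSubalgebra_stdHyperplane_mem_red (F : Fin ((m + 1) * m) ≃ (Fin m × Fin m) ⊕ Fin m) :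
    nilSubalgebra (stdHyperplane m) ∈ Red (m + 1) := by
  have h : algebraPoint F 1 0 = 0 := by
    ext s
    simp only [algebraPoint]
    rcases F s.2 with pq | p <;> simp
  rw [← grChart_chartBasis_zero F, ← h]
  exact grChart_algebraPoint_mem_red 1 0 F

end Orbits

/-! ### The variety `Cₙ` -/

section TangentCone

variable {n : ℕ}

/-- The commutators of the values of `B` are of the form forced by a commuting extension of `B` to
endomorphisms of `ℂⁿ`. -/
def HasRankTwoCommutators (B : HomEnd n) : Prop :=
  ∃ β : (Fin (n - 1) → ℂ) → (Fin (n - 1) → ℂ), ∀ u v,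
    B u * B v - B v * B u = vecMulVec u (β v) - vecMulVec v (β u)

lemma HasRankTwoCommutators.smul {B : HomEnd n} (h : HasRankTwoCommutators B) (c : ℂ) :
    HasRankTwoCommutators (c • B) := by
  obtain ⟨β, hβ⟩ := h
  refine ⟨fun v => (c * c) • β v, fun u v => ?_⟩
  have : (c • B) u * (c • B) v - (c • B) v * (c • B) u = (c * c) • (B u * B v - B v * B u) := by
    simp [smul_smul, smul_sub]
  rw [this, hβ, vecMulVec_smul, vecMulVec_smul, smul_sub]

lemma HasRankTwoCommutators.glAct {B : HomEnd n} (h : HasRankTwoCommutators B)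
    (g : GL (Fin (n - 1)) ℂ) : HasRankTwoCommutators (glAct g B) := by
  obtain ⟨β, hβ⟩ := h
  refine ⟨fun v => β (g⁻¹.val *ᵥ v) ᵥ* g⁻¹.val, fun u v => ?_⟩
  have hinv : g⁻¹.val * g.val = 1 := Units.inv_mul g
  have hinv' : g.val * g⁻¹.val = 1 := Units.mul_inv g
  have h1 (M N : Matrix (Fin (n - 1)) (Fin (n - 1)) ℂ) :
      g.val * M * g⁻¹.val * (g.val * N * g⁻¹.val) = g.val * (M * N) * g⁻¹.val := by
    simp only [mul_assoc]
    rw [← mul_assoc g⁻¹.val g.val, hinv, one_mul]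
  have h2 (u w : Fin (n - 1) → ℂ) : g.val * vecMulVec (g⁻¹.val *ᵥ u) w * g⁻¹.val =
      vecMulVec u (w ᵥ* g⁻¹.val) := by
    rw [mul_vecMulVec, vecMulVec_mul, mulVec_mulVec, hinv', one_mulVec]
  change g.val * B (g⁻¹.val *ᵥ u) * g⁻¹.val * (g.val * B (g⁻¹.val *ᵥ v) * g⁻¹.val) -
    g.val * B (g⁻¹.val *ᵥ v) * g⁻¹.val * (g.val * B (g⁻¹.val *ᵥ u) * g⁻¹.val) = _
  rw [h1, h1, ← sub_mul, ← mul_sub, hβ, mul_sub, sub_mul, h2, h2]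

lemma cyclicMatrix_pow_apply (hn : 0 < n) (k : ℕ) (p q : Fin n) :
    (cyclicMatrix n ^ k) p q = if (p : ℕ) = ((q : ℕ) + k) % n then 1 else 0 := by
  induction k generalizing p with
  | zero => simp [Matrix.one_apply, Nat.mod_eq_of_lt q.2, Fin.ext_iff]
  | succ k ih =>
    rw [pow_succ', Matrix.mul_apply,
      Finset.sum_eq_single (⟨(q + k) % n, Nat.mod_lt _ hn⟩ : Fin n)]
    · rw [ih, if_pos rfl, mul_one, cyclicMatrix, Matrix.of_apply, Nat.mod_add_mod, add_assoc]
    · intro l _ hl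
      rw [ih, if_neg, mul_zero]
      intro h
      exact hl (Fin.ext h)
    · simp

lemma cyclicB_single (i : Fin (n - 1)) :
    cyclicB n (Pi.single i 1) = compression (cyclicMatrix n ^ ((i : ℕ) + 1)) := by
  simp [cyclicB, Pi.single_apply, LinearMap.sum_apply]

/-- The combinations M(u) = ∑ uᵢ Jⁱ of powers of J commute, have last column u above the corner and
compress to B(u). The upper left block of [M(u), M(v)] = 0 is the required relation. -/
lemma hasRankTwoCommutators_cyclicB (m : ℕ) : HasRankTwoCommutators (cyclicB (m + 1)) := by
  let M (u : Fin m → ℂ) : Matrix (Fin (m + 1)) (Fin (m + 1)) ℂ :=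
    ∑ i : Fin m, u i • cyclicMatrix (m + 1) ^ ((i : ℕ) + 1)
  have hM (u : Fin m → ℂ) : ∃ β d, M u = blockMat (cyclicB (m + 1) u) u β d := by
    refine ⟨fun q => M u (Fin.last m) q.castSucc, M u (Fin.last m) (Fin.last m), ?_⟩
    apply ext_castSucc_last
    · intro p q
      rw [blockMat_castSucc_castSucc]
      simp only [M, Matrix.sum_apply, Matrix.smul_apply, cyclicB, LinearMap.sum_apply,
        LinearMap.smulRight_apply, LinearMap.proj_apply, smul_eq_mul]
      rfl
    · intro p
      refine Eq.trans ?_ (blockMat_castSucc_last _ _ _ _ p).symm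
      simp only [M, Matrix.sum_apply, Matrix.smul_apply, smul_eq_mul]
      rw [Finset.sum_eq_single p]
      · rw [cyclicMatrix_pow_apply (Nat.succ_pos m), if_pos, mul_one]
        rw [Fin.val_castSucc, Fin.val_last, show m + ((p : ℕ) + 1) = p + (m + 1) by ring,
          Nat.add_mod_right, Nat.mod_eq_of_lt (p.2.trans (Nat.lt_succ_self m))]
      · intro i _ hi
        rw [cyclicMatrix_pow_apply (Nat.succ_pos m), if_neg, mul_zero]
        rw [Fin.val_castSucc, Fin.val_last, show m + ((i : ℕ) + 1) = i + (m + 1) by ring,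
          Nat.add_mod_right, Nat.mod_eq_of_lt (i.2.trans (Nat.lt_succ_self m))]
        exact fun h => hi (Fin.ext h.symm)
      · simp
    · intro q
      simp
    · simp
  choose β d hβ using hM
  have hcomm (u v : Fin m → ℂ) : M u * M v = M v * M u := by
    simp only [M, Finset.sum_mul_sum]
    rw [Finset.sum_comm]
    refine Finset.sum_congr rfl fun i _ => Finset.sum_congr rfl fun j _ => ?_
    rw [Matrix.smul_mul, Matrix.mul_smul, Matrix.smul_mul, Matrix.mul_smul, smul_comm,
      ← pow_add, ← pow_add, add_comm ((j : ℕ) + 1)]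
  refine ⟨fun v => -β v, fun u v => ?_⟩
  have h := hcomm u v
  rw [hβ, hβ, blockMat_mul, blockMat_mul] at h
  ext p q
  have h1 := congrFun (congrFun h (Fin.castSucc p)) (Fin.castSucc q)
  rw [blockMat_castSucc_castSucc, blockMat_castSucc_castSucc, Matrix.add_apply,
    Matrix.add_apply] at h1
  rw [vecMulVec_neg, vecMulVec_neg, Matrix.sub_apply, Matrix.sub_apply, Matrix.neg_apply,
    Matrix.neg_apply]
  linear_combination h1

/-- The quadratic polynomial which is the `(k, l)` entry of the commutator of the values of an
element of `Hom(U, End U)` at the `i`-th and the `j`-th basis vectors. -/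
def commutatorPoly (i j k l : Fin (n - 1)) :
    MvPolynomial (Fin (n - 1) × Fin (n - 1) × Fin (n - 1)) ℂ :=
  ∑ a, MvPolynomial.X (i, a, k) * MvPolynomial.X (j, l, a) -
    ∑ a, MvPolynomial.X (j, a, k) * MvPolynomial.X (i, l, a)

lemma commutatorPoly_isHomogeneous (i j k l : Fin (n - 1)) :
    (commutatorPoly i j k l).IsHomogeneous 2 := by
  refine MvPolynomial.IsHomogeneous.sub ?_ ?_ <;>
    exact MvPolynomial.IsHomogeneous.sum _ _ _ fun a _ =>
      (MvPolynomial.isHomogeneous_X _ _).mul (MvPolynomial.isHomogeneous_X _ _)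

lemma eval_commutatorPoly (i j k l : Fin (n - 1)) (B : HomEnd n) :
    MvPolynomial.eval (homEndCoord B) (commutatorPoly i j k l) =
      (B (Pi.single i 1) * B (Pi.single j 1) - B (Pi.single j 1) * B (Pi.single i 1)) k l := by
  simp [commutatorPoly, homEndCoord, Matrix.mul_apply]

/-- For u = eᵢ and v = eⱼ the right-hand side is supported in rows i and j. -/
lemma HasRankTwoCommutators.eval_commutatorPoly {B : HomEnd n} (h : HasRankTwoCommutators B)
    {i j k l : Fin (n - 1)} (hi : k ≠ i) (hj : k ≠ j) :
    MvPolynomial.eval (homEndCoord B) (commutatorPoly i j k l) = 0 := by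
  obtain ⟨β, hβ⟩ := h
  rw [_root_.eval_commutatorPoly, hβ]
  simp [vecMulVec_apply, hi, hj]

lemma eval_commutatorPoly_smul (i j k l : Fin (n - 1)) (c : ℂ) (B : HomEnd n) :
    MvPolynomial.eval (homEndCoord (c • B)) (commutatorPoly i j k l) =
      c ^ 2 * MvPolynomial.eval (homEndCoord B) (commutatorPoly i j k l) := by
  rw [eval_commutatorPoly, eval_commutatorPoly]
  simp
  ring

/-- A linear subspace containing [B] and [h • B] contains [B + h • B], whereas a quadric vanishing
on the whole orbit is nonzero there. -/
theorem not_linear_cvar (hn : 4 ≤ n) : ¬ ∃ T : Projectivization.Subspace ℂ (HomEnd n),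
    (T : Set (Projectivization ℂ (HomEnd n))) = Cvar n := by
  rintro ⟨T, hT⟩
  have hB : HasRankTwoCommutators (cyclicB n) := by
    obtain ⟨m, rfl⟩ := Nat.exists_eq_succ_of_ne_zero (by omega : n ≠ 0)
    exact hasRankTwoCommutators_cyclicB m
  -- Counting from 0, i and j correspond to J and J^(n-1), which are inverse to each other, so each
  -- of the two sums in the (k, k) entry has one nonzero term. Having k ≠ j requires n ≥ 4.
  let i : Fin (n - 1) := ⟨0, by omega⟩
  let j : Fin (n - 1) := ⟨n - 2, by omega⟩
  let k : Fin (n - 1) := ⟨1, by omega⟩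
  let l : Fin (n - 1) := ⟨2, by omega⟩
  have hki : k ≠ i := by simp [k, i]
  have hkj : k ≠ j := by simp [k, j]; omega
  have hli : l ≠ i := by simp [l, i]
  have hji : j ≠ i := by simp [j, i]; omega
  have hvanish : ∀ x ∈ T, MvPolynomial.eval (homEndCoord x.rep) (commutatorPoly i j k k) = 0 := by
    intro x hx
    have hx' : x ∈ Cvar n := hT ▸ hx
    refine hx' 2 _ (commutatorPoly_isHomogeneous i j k k) ?_
    rintro _ ⟨g, hg, rfl⟩
    obtain ⟨a, ha⟩ := Projectivization.exists_smul_eq_mk_rep ℂ _ hg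
    rw [← ha]
    exact ((hB.glAct g).smul a.val).eval_commutatorPoly hki hkj
  have horbit (g : GL (Fin (n - 1)) ℂ) (h : glAct g (cyclicB n) ≠ 0) :
      Projectivization.mk ℂ _ h ∈ T := by
    rw [← SetLike.mem_coe, hT]
    intro d f _ hf
    exact hf _ ⟨g, h, rfl⟩
  -- Scaling only eᵢ already suffices to break the relation.
  let t : Fin (n - 1) → ℂ := fun a => if a = i then 2 else 1
  have ht (a : Fin (n - 1)) : t a ≠ 0 := by
    simp only [t]; split_ifs <;> norm_num
  let h : GL (Fin (n - 1)) ℂ :=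
    ⟨diagonal t, diagonal t⁻¹, by simp [ht, ← diagonal_one], by simp [ht, ← diagonal_one]⟩
  have hone : glAct 1 (cyclicB n) = cyclicB n := by
    refine LinearMap.ext fun u => ?_
    simp [glAct]
  have hentry (a p q : Fin (n - 1)) : glAct h (cyclicB n) (Pi.single a 1) p q =
      t p * (t a)⁻¹ * (t q)⁻¹ * cyclicB n (Pi.single a 1) p q := by
    have h1 : diagonal t⁻¹ *ᵥ Pi.single a 1 = (t a)⁻¹ • (Pi.single a 1 : Fin (n - 1) → ℂ) := by
      ext b
      by_cases hb : b = a
      · subst hb; simp [mulVec_diagonal]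
      · simp [mulVec_diagonal, hb]
    change (diagonal t * cyclicB n (diagonal t⁻¹ *ᵥ Pi.single a 1) * diagonal t⁻¹) p q = _
    rw [h1, map_smul, mul_diagonal, diagonal_mul]
    simp
    ring
  have hcyc (a p q : Fin (n - 1)) : cyclicB n (Pi.single a 1) p q =
      if (p : ℕ) = ((q : ℕ) + (a + 1)) % n then 1 else 0 := by
    rw [cyclicB_single]
    exact cyclicMatrix_pow_apply (by omega) _ _ _
  set z := glAct 1 (cyclicB n) + glAct h (cyclicB n)
  have hz (a p q : Fin (n - 1)) : z (Pi.single a 1) p q =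
      (1 + t p * (t a)⁻¹ * (t q)⁻¹) * if (p : ℕ) = ((q : ℕ) + (a + 1)) % n then 1 else 0 := by
    have : z (Pi.single a 1) p q = cyclicB n (Pi.single a 1) p q +
      glAct h (cyclicB n) (Pi.single a 1) p q := by simp only [z, hone]; rfl
    rw [this, hentry, hcyc]
    ring
  have hti : t i = 2 := if_pos rfl
  have htj : t j = 1 := if_neg hji
  have htk : t k = 1 := if_neg hki
  have htl : t l = 1 := if_neg hli
  -- The surviving terms are (1 + 1/4)(1 + 2) = 15/4, from the index i, and (1 + 1)(1 + 1/2) = 3,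
  -- from the index l.
  have hquad : MvPolynomial.eval (homEndCoord z) (commutatorPoly i j k k) = 3 / 4 := by
    rw [eval_commutatorPoly, Matrix.sub_apply, Matrix.mul_apply, Matrix.mul_apply,
      Finset.sum_eq_single i, Finset.sum_eq_single l]
    · simp only [hz]
      have e1 : ((k : ℕ) = ((i : ℕ) + (i + 1)) % n) := by
        simp only [k, i]; rw [Nat.mod_eq_of_lt] <;> omega
      have e2 : ((i : ℕ) = ((k : ℕ) + (j + 1)) % n) := by
        simp only [k, i, j]; rw [show 1 + (n - 2 + 1) = n by omega, Nat.mod_self]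
      have e3 : ((k : ℕ) = ((l : ℕ) + (j + 1)) % n) := by
        simp only [k, l, j]
        rw [show 2 + (n - 2 + 1) = 1 + n by omega, Nat.add_mod_right, Nat.mod_eq_of_lt (by omega)]
      have e4 : ((l : ℕ) = ((k : ℕ) + (i + 1)) % n) := by
        simp only [k, i, l]; rw [Nat.mod_eq_of_lt] <;> omega
      rw [if_pos e1, if_pos e2, if_pos e3, if_pos e4, hti, htj, htk, htl]
      norm_num
    · intro a _ ha
      rw [hz j, if_neg]
      · simp
      · intro hcon
        apply ha
        have := a.2
        simp only [k, j] at hcon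
        rw [show (a : ℕ) + (n - 2 + 1) = a + (n - 1) by omega] at hcon
        apply Fin.ext
        simp only [l]
        rcases Nat.eq_zero_or_pos (a : ℕ) with h0 | h0
        · rw [h0, Nat.mod_eq_of_lt (by omega)] at hcon; omega
        · rw [show (a : ℕ) + (n - 1) = (a - 1) + n by omega, Nat.add_mod_right,
            Nat.mod_eq_of_lt (by omega)] at hcon
          omega
    · simp
    · intro a _ ha
      rw [hz i, if_neg]
      · simp
      · intro hcon
        apply ha
        have := a.2
        simp only [k, i] at hcon
        rw [Nat.mod_eq_of_lt (by omega)] at hcon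
        apply Fin.ext
        simp only [i]
        omega
    · simp
  have hB0 : cyclicB n ≠ 0 := by
    intro h0
    have := hcyc i k i
    rw [h0, if_pos] at this
    · simp at this
    · simp only [k, i]; rw [Nat.mod_eq_of_lt] <;> omega
  have hB1 : glAct 1 (cyclicB n) ≠ 0 := by rwa [hone]
  have hB2 : glAct h (cyclicB n) ≠ 0 := by
    intro h0
    have := hentry i k i
    rw [h0, hcyc, if_pos, hti, htk] at this
    · norm_num at this
    · simp only [k, i]; rw [Nat.mod_eq_of_lt] <;> omega
  have hz0 : z ≠ 0 := by
    intro h0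
    rw [h0, eval_commutatorPoly] at hquad
    norm_num at hquad
  have hzT := T.mem_add _ _ hB1 hB2 hz0 (horbit 1 hB1) (horbit h hB2)
  have hev := hvanish _ hzT
  obtain ⟨a, ha⟩ := Projectivization.exists_smul_eq_mk_rep ℂ z hz0
  rw [← ha] at hev
  have hev' : MvPolynomial.eval (homEndCoord (a.val • z)) (commutatorPoly i j k k) = 0 := hev
  rw [eval_commutatorPoly_smul, hquad] at hev'
  simp at hev'

end TangentCone

/-! ### The minimal orbits in the variety of reductions -/

section MinimalOrbits

variable {m : ℕ}

lemma chartIdeal_anti {V : Type*} [AddCommGroup V] [Module ℂ V] {k N : ℕ}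
    (b : Module.Basis (Fin k ⊕ Fin N) ℂ V) {Y Z : Set (Submodule ℂ V)} (h : Y ⊆ Z) :
    chartIdeal b Z ≤ chartIdeal b Y :=
  MvPolynomial.vanishingIdeal_anti_mono (Set.preimage_mono h)

lemma chartIdeal_le_originIdeal {V : Type*} [AddCommGroup V] [Module ℂ V] {k N : ℕ}
    (b : Module.Basis (Fin k ⊕ Fin N) ℂ V) {Z : Set (Submodule ℂ V)} (h : grChart b 0 ∈ Z) :
    chartIdeal b Z ≤ originIdeal (Fin k × Fin N) := by
  intro p hp
  rw [mem_originIdeal]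
  have := MvPolynomial.mem_vanishingIdeal_iff.mp hp 0 h
  simpa using this

/-- At a translate of the algebra of a hyperplane, the chart obtained by translating the chart
`chartBasis F` has the required properties. -/
lemma exists_chart_of_map_nilSubalgebra (hm : 3 ≤ m) (θ : Sl (m + 1) ≃ₗ⁅ℂ⁆ Sl (m + 1)) :
    ∃ b : Module.Basis (Fin m ⊕ Fin ((m + 1) * m)) ℂ (Sl (m + 1)),
      IsCentredAt b ((nilSubalgebra (stdHyperplane m)).map θ.toLinearEquiv.toLinearMap) ∧
      (nilSubalgebra (stdHyperplane m)).map θ.toLinearEquiv.toLinearMap ∈ Red (m + 1) ∧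
      ¬ IsRegularLocalRing (LocalRingAtOrigin (chartIdeal b (Red (m + 1)))) ∧
      HasTangentDimAtOrigin (abSchemeIdeal b) ((m + 1) * m ^ 2 / 2) ∧
      HasTangentDimAtOrigin (chartIdeal b (AbVar (m + 1))) ((m + 1) * m ^ 2 / 2) := by
  let F : Fin ((m + 1) * m) ≃ (Fin m × Fin m) ⊕ Fin m :=
    Fintype.equivOfCardEq (by simp; ring)
  have hRed := map_mem_red θ (nilSubalgebra_stdHyperplane_mem_red F)
  have hcentre : grChart ((chartBasis F).map θ.toLinearEquiv) 0 =
      (nilSubalgebra (stdHyperplane m)).map θ.toLinearEquiv.toLinearMap := by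
    rw [grChart_map, grChart_chartBasis_zero]
  refine ⟨(chartBasis F).map θ.toLinearEquiv, hcentre, hRed, ?_⟩
  -- All the ideals involved lie between the equations of the standard chart, which bound the
  -- tangent space from above, and the ideal of `Red`, whose tangent vectors bound it from below.
  have hchain₁ : abSchemeIdeal (chartBasis F) ≤
      abSchemeIdeal ((chartBasis F).map θ.toLinearEquiv) := abSchemeIdeal_le_map _ θ
  have hchain₂ : abSchemeIdeal ((chartBasis F).map θ.toLinearEquiv) ≤
      chartIdeal ((chartBasis F).map θ.toLinearEquiv) (AbVar (m + 1)) :=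
    abSchemeIdeal_le_chartIdeal (n := m + 1) _
  have hchain₃ : chartIdeal ((chartBasis F).map θ.toLinearEquiv) (AbVar (m + 1)) ≤
      chartIdeal ((chartBasis F).map θ.toLinearEquiv) (Red (m + 1)) :=
    chartIdeal_anti _ (red_subset_abVar (m + 1))
  have hchain₄ : chartIdeal ((chartBasis F).map θ.toLinearEquiv) (Red (m + 1)) ≤
      originIdeal _ := chartIdeal_le_originIdeal _ (hcentre ▸ hRed)
  have hdir {J : Ideal (MvPolynomial (Fin m × Fin ((m + 1) * m)) ℂ)}
      (hJ : J ≤ chartIdeal ((chartBasis F).map θ.toLinearEquiv) (Red (m + 1)))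
      (t : SymIndex m) : symDirection F t ∈ tangentAtOrigin J := by
    rw [chartIdeal_map _ _ (map_mem_red_iff θ)] at hJ
    exact tangentAtOrigin_anti hJ (symDirection_mem F t)
  have hgen {J : Ideal (MvPolynomial (Fin m × Fin ((m + 1) * m)) ℂ)}
      (hJ : abSchemeIdeal ((chartBasis F).map θ.toLinearEquiv) ≤ J) (s) :
      MvPolynomial.X s ∈ J ⊔ Ideal.span (Set.range fun t => MvPolynomial.X (symCoord F t)) :=
    sup_le_sup_right (hchain₁.trans hJ) _ (X_mem_abSchemeIdeal_sup F (by omega) s)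
  rw [← card_symIndex]
  refine ⟨?_, hasTangentDimAtOrigin_of_coords ((hchain₂.trans hchain₃).trans hchain₄)
      (hdir (hchain₂.trans hchain₃)) (symDirection_symCoord F) (hgen le_rfl),
    hasTangentDimAtOrigin_of_coords (hchain₃.trans hchain₄)
      (hdir hchain₃) (symDirection_symCoord F) (hgen hchain₂)⟩
  -- Three distinct indices exist because m ≥ 3. They provide a row of the commutator free of β.
  let i : Fin m := ⟨0, by omega⟩
  let j : Fin m := ⟨1, by omega⟩
  let k : Fin m := ⟨2, by omega⟩
  have hij : i < j := by simp [i, j]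
  have hik : i ≠ k := by simp [i, k]
  have hjk : j ≠ k := by simp [j, k]
  refine not_isRegularLocalRing_of_coords hchain₄ (hdir le_rfl) (symDirection_symCoord F)
    (hgen (hchain₂.trans hchain₃)) (a := (⟨(i, i), le_rfl⟩, i)) (b := (⟨(i, j), hij.le⟩, k)) ?_
    (sup_le_sup_right (hchain₁.trans (hchain₂.trans hchain₃)) _
      (X_mul_X_mem_abSchemeIdeal_sup F hij hik hjk))
  intro h
  exact hik (congrArg Prod.snd h)

end MinimalOrbits

end

theorem proposition11 (n : ℕ) (hn : 4 ≤ n) :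
    (OMin' n ⊆ grSingularLocus (n - 1) (n * (n - 1)) (Red n) ∧
      OMin'' n ⊆ grSingularLocus (n - 1) (n * (n - 1)) (Red n)) ∧
    (∀ W ∈ OMin' n ∪ OMin'' n, W ∈ AbVar n ∧
      ∃ b : Module.Basis (Fin (n - 1) ⊕ Fin (n * (n - 1))) ℂ (Sl n), IsCentredAt b W ∧
        HasTangentDimAtOrigin (abSchemeIdeal b) (n * (n - 1) ^ 2 / 2) ∧
        HasTangentDimAtOrigin (chartIdeal b (AbVar n)) (n * (n - 1) ^ 2 / 2)) ∧
    ¬ ∃ T : Projectivization.Subspace ℂ (HomEnd n),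
      (T : Set (Projectivization ℂ (HomEnd n))) = Cvar n := by
  refine ⟨?_, ?_, not_linear_cvar hn⟩ <;>
    obtain ⟨m, rfl⟩ := Nat.exists_eq_succ_of_ne_zero (by omega : n ≠ 0)
  · constructor <;> intro W hW
    · obtain ⟨θ, rfl⟩ := exists_eq_map_of_mem_oMin' hW
      obtain ⟨b, hb, hRed, hsing, -⟩ := exists_chart_of_map_nilSubalgebra (by omega) θ
      exact ⟨hRed, b, hb, hsing⟩
    · obtain ⟨θ, rfl⟩ := exists_eq_map_of_mem_oMin'' hW
      obtain ⟨b, hb, hRed, hsing, -⟩ := exists_chart_of_map_nilSubalgebra (by omega) θ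
      exact ⟨hRed, b, hb, hsing⟩
  · intro W hW
    obtain ⟨θ, rfl⟩ := hW.elim exists_eq_map_of_mem_oMin' exists_eq_map_of_mem_oMin''
    obtain ⟨b, hb, hRed, -, htan⟩ := exists_chart_of_map_nilSubalgebra (by omega) θ
    exact ⟨red_subset_abVar _ hRed, b, hb, htan⟩
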